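/- Let $(G,\Omega)$ be an oligomorphic group, i.e. a group $G$ of permutations of a set $\Omega$ having finitely many orbits on $\Omega^{\ell}$ for every $\ell\ge 0$. For a finite subset $A\subset\Omega$ let $G(A)$ and $G[A]$ be the subgroups of $G$ fixing $A$ pointwise and setwise, respectively. An $\mathscr{E}(\Omega)$-smooth $G$-set is a set with an action of $G$ that has finitely many orbits and such that the stabilizer of every element is of the form $G(A)$ with $A\subset\Omega$ finite; it is transitive if it consists of exactly one orbit. Let $\Theta(G,\Omega)$ be the commutative ring generated by symbols $[f]$, one for each $G$-equivariant map $f\colon Y\to X$ of $\mathscr{E}(\Omega)$-smooth $G$-sets with $X$ transitive, subject to the following relations: 1. $[f]=1$ if $f$ is an isomorphism; 2. $[f]=[f|_{Y_1}]+[f|_{Y_2}]$ if $Y=Y_1\sqcup Y_2$ as $G$-sets; 3. $[f\circ g]=[f]\,[g]$ for composable maps $g\colon Z\to Y$, $f\colon Y\to X$ of transitive $\mathscr{E}(\Omega)$-smooth $G$-sets; 4. $[f]=[f']$ if $f'\colon Y\times_X X'\to X'$ is the base change of $f\colon Y\to X$ along a map $X'\to X$ of transitive $\mathscr{E}(\Omega)$-smooth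 $G$-sets. Call $[f]$ a basic class if, for some $\ell\ge0$, $f\colon Y\to X$ is the restriction of the projection $\Omega^{\ell+1}\to\Omega^{\ell}$ onto the first $\ell$ coordinates to a $G$-orbit $Y$ on $\Omega^{\ell+1}$ and its image $X$ in $\Omega^{\ell}$. Let $\Theta_{\le 1}(G,\Omega)$ be the additive subgroup of $\Theta(G,\Omega)$ generated by the basic classes. Suppose that - $\mathrm{GEN}(1)$: $\Theta_{\le 1}(G,\Omega)$ is a finitely generated abelian group, and - $\mathrm{IND}(1)$: $[G[A]:G(A)]=1$, i.e. $G(A)=G[A]$, for every finite subset $A\subset\Omega$. Then: (a) There is a ring isomorphism $\Theta(G,\Omega)\cong\mathbf{Z}^n$ for some $n\ge0$. (b) Under any such isomorphism, if $f\colon Y\to X$ is a map of transitive $\mathscr{E}(\Omega)$-smooth $G$-sets and $(a_1,\dots,a_n)\in\mathbf{Z}^n$ is the element corresponding to $[f]$, then each $a_i$ belongs to $\{-1,0,1\}$. (c) If $r$ is the rank of the abelian group $\Theta_{\le 1}(G,\Omega)$, then $n\le 2^r$. -/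

import Mathlib

open scoped Pointwise

universe u

namespace Oligo

/-- The permutation action of `G` on `Ω` is oligomorphic: `G` has finitely many orbits on `Ω ^ n`
for every `n`. -/
def IsOligomorphic (G Ω : Type u) [Group G] [MulAction G Ω] : Prop :=
  ∀ n : ℕ, Finite (MulAction.orbitRel.Quotient G (Fin n → Ω))

/-- The class `𝓔(Ω)` of the subgroups `G(A)` (pointwise stabilizers) with `A ⊆ Ω` finite.
They are open for the topology of `G`, of which they form a neighbourhood basis of `1`. -/
def stabClass (G Ω : Type u) [Group G] [MulAction G Ω] : Set (Subgroup G) :=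
  {U | ∃ A : Finset Ω, U = fixingSubgroup G (A : Set Ω)}

/-- `IND(m)`: the index of the pointwise stabilizer `G(A)` in the setwise stabilizer `G[A]` divides
a power of `m`, for all finite `A ⊆ Ω`. (An infinite index would count as `0`.) -/
def IND (G Ω : Type u) [Group G] [MulAction G Ω] (m : ℕ) : Prop :=
  ∀ A : Finset Ω, ∃ s : ℕ,
    (fixingSubgroup G (A : Set Ω)).relIndex (MulAction.stabilizer G (A : Set Ω)) ∣ m ^ s

/-- An `E`-smooth `G`-set, for a class `E` of (open) subgroups of `G`: a set with an action of `G`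
that has finitely many orbits and all of whose point stabilizers belong to `E`. -/
structure SmoothSet (G : Type u) [Group G] (E : Set (Subgroup G)) where
  /-- the underlying set -/
  carrier : Type u
  /-- the action of `G` -/
  [action : MulAction G carrier]
  finitary : Finite (MulAction.orbitRel.Quotient G carrier)
  stabilizer_mem : ∀ x : carrier, MulAction.stabilizer G x ∈ E

section Theta

variable {G : Type u} [Group G] {E : Set (Subgroup G)}

instance : CoeSort (SmoothSet G E) (Type u) := ⟨SmoothSet.carrier⟩

instance (X : SmoothSet G E) : MulAction G X := X.action

/-- A transitive `G`-set consists of exactly one orbit; in particular it is non-empty. -/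
def SmoothSet.IsTransitive (X : SmoothSet G E) : Prop :=
  Nonempty X ∧ MulAction.IsPretransitive G X

variable (G E) in
/-- The symbols on which a measure is defined: maps `f : Y → X` of `E`-smooth `G`-sets with
`X` transitive. -/
structure Mor where
  /-- the source `Y` -/
  source : SmoothSet G E
  /-- the target `X` -/
  target : SmoothSet G E
  /-- the map `f`, which is `G`-equivariant -/
  hom : source →[G] target
  transitive : target.IsTransitive

/-- The commutative square with `f' : Y' → X'`, `f : Y → X`, `h : Y' → Y`, `g : X' → X` is
cartesian, i.e. `f'` is the base change of `f` along `g`: the square commutes and `Y'` maps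
bijectively to the fiber product of `Y` and `X'` over `X`. -/
def IsBaseChange {Y' X' Y X : SmoothSet G E} (f' : Y' →[G] X') (f : Y →[G] X)
    (h : Y' →[G] Y) (g : X' →[G] X) : Prop :=
  (∀ y', f (h y') = g (f' y')) ∧
    ∀ (y : Y) (x' : X'), f y = g x' → ∃! y' : Y', h y' = y ∧ f' y' = x'

/-- The defining relations of the ring `Θ(G, E)`, as elements of the polynomial ring in the
symbols. -/
inductive Rel : MvPolynomial (Mor G E) ℤ → Prop
  /-- `[f] = 1` if `f` is an isomorphism. -/
  | iso {Y X : SmoothSet G E} (hX : X.IsTransitive) (f : Y →[G] X)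
      (hf : Function.Bijective f) :
      Rel (MvPolynomial.X ⟨Y, X, f, hX⟩ - 1)
  /-- `[f] = [f₁] + [f₂]` if `Y` is the disjoint union of `Y₁` and `Y₂` (via `i₁`, `i₂`) and `fₖ`
  is the restriction of `f` to `Yₖ`. -/
  | add {Y Y₁ Y₂ X : SmoothSet G E} (hX : X.IsTransitive) (f : Y →[G] X)
      (i₁ : Y₁ →[G] Y) (i₂ : Y₂ →[G] Y)
      (hi : Function.Bijective (Sum.elim i₁ i₂ : Y₁ ⊕ Y₂ → Y)) :
      Rel (MvPolynomial.X ⟨Y, X, f, hX⟩ - (MvPolynomial.X ⟨Y₁, X, f.comp i₁, hX⟩ + MvPolynomial.X ⟨Y₂, X, f.comp i₂, hX⟩))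
  /-- `[f ∘ g] = [f] [g]` for composable maps of transitive sets. -/
  | comp {Z Y X : SmoothSet G E} (hZ : Z.IsTransitive) (hY : Y.IsTransitive)
      (hX : X.IsTransitive) (f : Y →[G] X) (g : Z →[G] Y) :
      Rel (MvPolynomial.X ⟨Z, X, f.comp g, hX⟩ - MvPolynomial.X ⟨Y, X, f, hX⟩ * MvPolynomial.X ⟨Z, Y, g, hY⟩)
  /-- `[f] = [f']` if `f'` is the base change of `f` along a map of transitive sets. -/
  | baseChange {Y' X' Y X : SmoothSet G E} (hX : X.IsTransitive) (hX' : X'.IsTransitive)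
      (f' : Y' →[G] X') (f : Y →[G] X) (h : Y' →[G] Y) (g : X' →[G] X)
      (hsq : IsBaseChange f' f h g) :
      Rel (MvPolynomial.X ⟨Y, X, f, hX⟩ - MvPolynomial.X ⟨Y', X', f', hX'⟩)

variable (G E) in
/-- The ring `Θ(G, E)` carrying the universal measure: the polynomial ring in the symbols `[f]`
modulo the ideal generated by the defining relations of a measure. -/
abbrev Theta : Type (u + 1) :=
  MvPolynomial (Mor G E) ℤ ⧸ Ideal.span {p : MvPolynomial (Mor G E) ℤ | Rel p}

/-- The class `[f]` in `Θ(G, E)`. -/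
noncomputable def Mor.cls (f : Mor G E) : Theta G E :=
  Ideal.Quotient.mk _ (MvPolynomial.X f)

end Theta

section Filtration

variable (G : Type u) {Ω : Type u} [Group G] [MulAction G Ω]

/-- The stabilizer of a point of `Ω ^ n` fixes pointwise the finite set of its coordinates. -/
theorem stabilizer_tuple_mem {n : ℕ} (y : Fin n → Ω) :
    MulAction.stabilizer G y ∈ stabClass G Ω := by
  classical
  refine ⟨Finset.univ.image y, ?_⟩
  ext g
  simp [mem_fixingSubgroup_iff, MulAction.mem_stabilizer_iff, funext_iff]

/-- The orbit of a point `y` of `Ω ^ n`, as an `𝓔(Ω)`-smooth `G`-set. -/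
def orbitSet {n : ℕ} (y : Fin n → Ω) : SmoothSet G (stabClass G Ω) where
  carrier := MulAction.orbit G y
  finitary := by
    have := (MulAction.pretransitive_iff_subsingleton_quotient G (MulAction.orbit G y)).1
      inferInstance
    infer_instance
  stabilizer_mem x := by
    have h : MulAction.stabilizer G x = MulAction.stabilizer G (x : Fin n → Ω) := by
      ext g
      simp [MulAction.mem_stabilizer_iff, Subtype.ext_iff]
    rw [h]
    exact stabilizer_tuple_mem G _

theorem orbitSet_isTransitive {n : ℕ} (y : Fin n → Ω) : (orbitSet G y).IsTransitive :=
  ⟨⟨⟨y, MulAction.mem_orbit_self y⟩⟩,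
    inferInstanceAs (MulAction.IsPretransitive G (MulAction.orbit G y))⟩

/-- The basic map attached to `y ∈ Ω ^ (ℓ + 1)`: the projection onto the first `ℓ` coordinates,
restricted to a map from the orbit of `y` to the orbit of the image of `y`. -/
def basicMap {l : ℕ} (y : Fin (l + 1) → Ω) : Mor G (stabClass G Ω) where
  source := orbitSet G y
  target := orbitSet G (Fin.init y)
  hom :=
    { toFun := fun z => ⟨Fin.init z.1, by
        obtain ⟨g, hg⟩ := z.2
        exact ⟨g, by rw [← hg]; rfl⟩⟩
      map_smul' := fun _ _ => rfl }
  transitive := orbitSet_isTransitive G _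

variable (Ω)

/-- `Θ_{≤ 1}(G, Ω)`: the additive subgroup of `Θ(G, Ω) = Θ(G, 𝓔(Ω))` generated by the classes of
the basic maps. -/
noncomputable def thetaLEOne : Submodule ℤ (Theta G (stabClass G Ω)) :=
  Submodule.span ℤ {x | ∃ (l : ℕ) (y : Fin (l + 1) → Ω), x = (basicMap G y).cls}

/-- `GEN(1)`: the abelian group `Θ_{≤ 1}(G, Ω)` is finitely generated. -/
def GENOne : Prop := (thetaLEOne G Ω).FG

end Filtration

end Oligo

-- The engine is the set of cyclic words of prime length `p` in the fibers of a map `f : Y → X`.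
-- Since `G(A) = G[A]`, no group element moves points of a smooth set in a nontrivial finite cycle.
-- So a cyclic word has the same stabilizer as any word representing it (`Cyc.stabilizer_mk`), and
-- cyclic words again form a smooth set. The `p`-fold fiber power of `Y` over `X` consists of the
-- constant words, a copy of `Y`, and of words lying `p` to one over the nonconstant cyclic words.
-- Writing `nc(f)` for the class of the latter, `[f]^p = [f] + p nc(f)` (`cls_pow_prime`).
--
-- Put `δ(f) = -nc(f)`. On the polynomial ring in the symbols, `X_f ↦ X_f^p + p δ(f)` is a lift of
-- Frobenius that induces the identity on `Θ`. Counting cyclic words for disjoint unions,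
-- compositions and base changes (`cycCls_add`, `cycCls_comp`, `cycCls_eq_of_cart`) shows that the
-- ideal of relations is stable under `δ` (`exists_delta_mem_of_rel`). Hence `Θ` is torsion-free,
-- and `x ≡ x^p` modulo `p` for all `x` in `Θ` and all primes `p`.
--
-- If `Y` is transitive too, then `nc(f) = [f] c`: an orbit of cyclic words lifts to words, and its
-- map to `X` factors through the first letter (`exists_cls_ncHom_eq_mul`). So `[f]^p - [f] = p [f]
-- c`. An integer `a ≠ 0` with this property for all `p` has `a^(p-1) ≡ 1` modulo every prime `p`,
-- so no prime divides it; this gives (b). For a basic class, the `p - 1` letters after the first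
-- add one point of `Ω` each, so `c` is a combination of products of `p - 1` basic classes.
--
-- The basic classes generate `Θ` (`closure_basicClasses`). Under a homomorphism to a field of
-- characteristic zero their values span a finitely generated group; the relation for `p = 2` bounds
-- the denominators, and the relations for the other primes remove them (`map_eq_intCast`). So all
-- these homomorphisms are integer valued, and Nakayama's lemma with the Chinese remainder theorem
-- gives `Θ ≅ ℤ^n` (`exists_ringEquiv_pi_int`). For (c), the `n` projections stay distinct modulo 2,
-- and each is determined by its restriction to `Θ_{≤ 1}`, for which there are `2^r` possibilities.

universe v

namespace Oligo

/-! ### Commutative algebra: when a torsion-free ring with `x ≡ x ^ p` is a power of `ℤ`. -/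

section BinomialAlgebra

open Submodule

/-- `k ^ n` clears the denominators of `L ^ n` if `k` clears those of `L`. -/
theorem pow_mul_mem_one {K : Type*} [CommRing K] {L : Submodule ℤ K} {k : ℤ}
    (hk : ∀ y ∈ L, (k : K) * y ∈ (1 : Submodule ℤ K)) (n : ℕ) :
    ∀ c ∈ L ^ n, (k : K) ^ n * c ∈ (1 : Submodule ℤ K) := by
  induction n with
  | zero => intro c hc; simpa using hc
  | succ n ih =>
    intro c hc
    rw [pow_succ] at hc
    induction hc using Submodule.mul_induction_on' with
    | mem_mul_mem a ha b hb =>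
      obtain ⟨s, hs⟩ := Submodule.mem_one.1 (ih a ha)
      obtain ⟨t, ht⟩ := Submodule.mem_one.1 (hk b hb)
      refine Submodule.mem_one.2 ⟨s * t, ?_⟩
      rw [map_mul, hs, ht]; ring
    | add a _ b _ h1 h2 => rw [mul_add]; exact add_mem h1 h2

/-- The additive group generated by the products of `n` elements of `B`. -/
def spanPow {R : Type*} [CommRing R] (B : Set R) (n : ℕ) : AddSubgroup R :=
  (span ℤ B ^ n).toAddSubgroup

theorem one_mem_spanPow_zero {R : Type*} [CommRing R] (B : Set R) : 1 ∈ spanPow B 0 := by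
  change 1 ∈ span ℤ B ^ 0
  rw [pow_zero]
  exact Submodule.mem_one.2 ⟨1, map_one _⟩

theorem mul_mem_spanPow_succ {R : Type*} [CommRing R] {B : Set R} {n : ℕ} {a x : R} (ha : a ∈ B)
    (hx : x ∈ spanPow B n) : a * x ∈ spanPow B (n + 1) := by
  change a * x ∈ span ℤ B ^ (n + 1)
  rw [pow_succ']
  exact Submodule.mul_mem_mul (subset_span ha) hx

theorem mem_closure_of_mem_spanPow {R : Type*} [CommRing R] {B : Set R} {n : ℕ} {x : R}
    (hx : x ∈ spanPow B n) : x ∈ Subring.closure B := by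
  change x ∈ span ℤ B ^ n at hx
  induction n generalizing x with
  | zero =>
    rw [pow_zero] at hx
    obtain ⟨r, rfl⟩ := Submodule.mem_one.1 hx
    simp
  | succ n ih =>
    rw [pow_succ'] at hx
    induction hx using Submodule.mul_induction_on' with
    | mem_mul_mem a ha b hb =>
      refine mul_mem ?_ (ih hb)
      rw [← Submodule.mem_toAddSubgroup, Submodule.span_int_eq_addSubgroupClosure] at ha
      exact (AddSubgroup.closure_le (Subring.closure B).toAddSubgroup).2 Subring.subset_closure ha
    | add a _ b _ h1 h2 => exact add_mem h1 h2

theorem closure_fg_of_span_fg {R : Type*} [AddCommGroup R] [m : Module ℤ R] {B : Set R}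
    (h : (span ℤ B).FG) : (AddSubgroup.closure B).FG := by
  obtain rfl : m = AddCommGroup.toIntModule R := Subsingleton.elim _ _
  rw [← Submodule.span_int_eq_addSubgroupClosure]
  exact (Submodule.fg_iff_addSubgroup_fg _).1 h

theorem adjoin_eq_top_of_closure_eq_top {R : Type*} [CommRing R] {B : Set R}
    (h : Subring.closure B = ⊤) : Algebra.adjoin ℤ B = ⊤ := by
  rw [eq_top_iff]
  rintro x -
  have hx : x ∈ Subring.closure B := h ▸ Subring.mem_top x
  exact (Subring.closure_le (t := (Algebra.adjoin ℤ B).toSubring)).2 Algebra.subset_adjoin hx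

/-- A homomorphism to a field of characteristic zero only takes integer values, if the nonzero
values of the generators satisfy `x ^ (p - 1) = 1 + p c` with `c` a combination of products of
`p - 1` generators. -/
theorem map_eq_intCast {R : Type*} [CommRing R] {B : Set R} (hfg : (span ℤ B).FG)
    (hgen : Algebra.adjoin ℤ B = ⊤)
    (hB : ∀ x ∈ B, ∀ p : ℕ, p.Prime → ∃ c ∈ span ℤ B ^ (p - 1), x ^ p - x = p * x * c)
    {K : Type*} [Field K] [CharZero K] (φ : R →+* K) (x : R) : ∃ n : ℤ, φ x = n := by
  classical
  set f : R →ₐ[ℤ] K := φ.toIntAlgHom with hf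
  have hfx : ∀ x, f x = φ x := fun _ => rfl
  set L : Submodule ℤ K := (span ℤ B).map f.toLinearMap ⊔ 1 with hL
  have hLfg : L.FG := (hfg.map _).sup (by rw [Submodule.one_eq_span]; exact fg_span_singleton _)
  have hBL : ∀ x ∈ B, φ x ∈ L := fun x hx =>
    mem_sup_left ⟨x, subset_span hx, rfl⟩
  have hpow : ∀ n, ∀ c ∈ span ℤ B ^ n, φ c ∈ L ^ n := by
    intro n c hc
    have h1 : f.toLinearMap c ∈ (span ℤ B ^ n).map f.toLinearMap := ⟨c, hc, rfl⟩
    rw [Submodule.map_pow] at h1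
    exact pow_le_pow_left' (le_sup_left : _ ≤ L) n h1
  have hkey : ∀ x ∈ B, φ x ≠ 0 → ∀ p : ℕ, p.Prime →
      ∃ c ∈ L ^ (p - 1), φ x ^ (p - 1) = 1 + p * c := by
    intro x hx hx0 p hp
    obtain ⟨c, hc, hc'⟩ := hB x hx p hp
    refine ⟨φ c, hpow _ c hc, mul_left_cancel₀ hx0 ?_⟩
    have h2 := congrArg φ hc'
    rw [map_sub, map_mul, map_mul, map_pow, map_natCast] at h2
    rw [← pow_succ', Nat.sub_add_cancel hp.one_le]
    linear_combination h2
  -- The prime 2 is special: `p - 1 = 1`, so `c` lies in `L` itself and Nakayama applies to `L`.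
  have hle : L ≤ 1 ⊔ (Ideal.span {(2 : ℤ)}) • L := by
    refine sup_le ?_ le_sup_left
    rw [Submodule.map_span, span_le]
    rintro _ ⟨x, hx, rfl⟩
    change φ x ∈ _
    by_cases hx0 : φ x = 0
    · rw [hx0]; exact zero_mem _
    obtain ⟨c, hc, h⟩ := hkey x hx hx0 2 Nat.prime_two
    simp only [Nat.add_one_sub_one, pow_one, Nat.cast_ofNat] at h hc
    rw [h]
    refine add_mem (mem_sup_left (Submodule.mem_one.2 ⟨1, by simp⟩)) (mem_sup_right ?_)
    have := Submodule.smul_mem_smul (Ideal.mem_span_singleton_self (2 : ℤ)) hc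
    simpa [zsmul_eq_mul] using this
  -- An odd, hence nonzero, `r` with `r L ⊆ ℤ`: a common denominator.
  obtain ⟨r, hr, hrL⟩ := exists_sub_one_mem_and_smul_le_of_fg_of_le_sup hLfg le_rfl hle
  have hr0 : r ≠ 0 := by
    rintro rfl
    obtain ⟨s, hs⟩ := Ideal.mem_span_singleton.1 hr
    omega
  have hex : ∃ k : ℕ, 0 < k ∧ ∀ y ∈ L, (k : K) * y ∈ (1 : Submodule ℤ K) := by
    refine ⟨r.natAbs, Int.natAbs_pos.2 hr0, fun y hy => ?_⟩
    have h1 : (r : K) * y ∈ (1 : Submodule ℤ K) := by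
      have := hrL (Submodule.smul_mem_pointwise_smul y r L hy)
      simpa [zsmul_eq_mul] using this
    rcases Int.natAbs_eq r with h | h
    · have h2 : ((r.natAbs : ℕ) : K) = (r : K) := by
        conv_rhs => rw [h]
        simp
      rwa [h2]
    · have h2 : ((r.natAbs : ℕ) : K) = -(r : K) := by
        conv_rhs => rw [h]
        simp
      rw [h2, neg_mul]; exact neg_mem h1
  obtain ⟨hk0, hk⟩ := Nat.find_spec hex
  set k := Nat.find hex with hkdef
  have hk1 : k = 1 := by
    by_contra hne
    obtain ⟨q, hq, k', hkk⟩ := Nat.exists_prime_and_dvd hne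
    have hq0 : (q : K) ≠ 0 := Nat.cast_ne_zero.2 hq.ne_zero
    have hk'0 : 0 < k' := Nat.pos_of_ne_zero (by rintro rfl; omega)
    -- A prime factor `q` of the least denominator `k = q k'` can be cancelled, contradicting
    -- minimality.
    refine Nat.find_min hex (m := k') ?_ ⟨hk'0, fun y hy => ?_⟩
    · rw [← hkdef, hkk]
      exact lt_mul_of_one_lt_left hk'0 hq.one_lt
    have hgenr : ∀ x ∈ B, (k' : K) * φ x ∈ (1 : Submodule ℤ K) := by
      intro x hx
      by_cases hx0 : φ x = 0
      · rw [hx0, mul_zero]; exact zero_mem _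
      obtain ⟨c, hc, h⟩ := hkey x hx hx0 q hq
      obtain ⟨m, hm⟩ := Submodule.mem_one.1
        (pow_mul_mem_one (k := (k : ℤ)) (by simpa using hk) _ c hc)
      obtain ⟨t, ht⟩ := Submodule.mem_one.1 (hk _ (hBL x hx))
      simp only [algebraMap_int_eq, eq_intCast, Int.cast_natCast] at hm ht
      -- Here `t = k φ(x)` and `m = k ^ (q - 1) c`, an integer because `c` lies in `L ^ (q - 1)`. As
      -- `q` divides `k` and `q - 1 > 0`, it divides `t`, so `k' φ(x) = t / q` is an integer.
      have h3 : t ^ (q - 1) = (k : ℤ) ^ (q - 1) + q * m := by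
        have : ((t ^ (q - 1) : ℤ) : K) = (((k : ℤ) ^ (q - 1) + q * m : ℤ) : K) := by
          push_cast
          rw [ht, hm, mul_pow, h]; ring
        exact_mod_cast this
      have h4 : (q : ℤ) ∣ t := by
        refine (Nat.prime_iff_prime_int.1 hq).dvd_of_dvd_pow (n := q - 1) ?_
        rw [h3]
        refine dvd_add (dvd_pow ?_ (by have := hq.two_le; omega)) (dvd_mul_right _ _)
        exact ⟨k', by exact_mod_cast hkk⟩
      obtain ⟨t', rfl⟩ := h4
      refine Submodule.mem_one.2 ⟨t', mul_left_cancel₀ hq0 ?_⟩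
      rw [hkk] at ht
      push_cast at ht
      simp only [algebraMap_int_eq, eq_intCast]
      rw [ht]; ring
    have hLs : L = span ℤ (φ '' B ∪ {1}) := by
      rw [hL, Submodule.map_span, span_union, Submodule.one_eq_span]; rfl
    rw [hLs] at hy
    induction hy using Submodule.span_induction with
    | mem y hy =>
      rcases hy with ⟨x, hx, rfl⟩ | rfl
      · exact hgenr x hx
      · exact Submodule.mem_one.2 ⟨k', by simp⟩
    | zero => simp
    | add a b _ _ h1 h2 => rw [mul_add]; exact add_mem h1 h2
    | smul n a _ h1 => rw [mul_smul_comm]; exact Submodule.smul_mem _ _ h1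
  have hx : x ∈ Algebra.adjoin ℤ B := hgen ▸ Algebra.mem_top
  induction hx using Algebra.adjoin_induction with
  | mem x hx =>
    obtain ⟨t, ht⟩ := Submodule.mem_one.1 (hk _ (hBL x hx))
    rw [hk1] at ht
    exact ⟨t, by simpa using ht.symm⟩
  | algebraMap r => exact ⟨r, by simp⟩
  | add a b _ _ h1 h2 =>
    obtain ⟨s, hs⟩ := h1
    obtain ⟨t, ht⟩ := h2
    exact ⟨s + t, by simp [hs, ht]⟩
  | mul a b _ _ h1 h2 =>
    obtain ⟨s, hs⟩ := h1
    obtain ⟨t, ht⟩ := h2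
    exact ⟨s * t, by simp [hs, ht]⟩

/-- If all homomorphisms to fields of characteristic zero only take integer values, then all
residue fields have positive characteristic. -/
theorem exists_prime_mem_of_isMaximal {R : Type v} [CommRing R]
    (hint : ∀ (K : Type v) [Field K] [CharZero K] (φ : R →+* K) (x : R), ∃ n : ℤ, φ x = n)
    (m : Ideal R) [hm : m.IsMaximal] : ∃ p : ℕ, p.Prime ∧ (p : R) ∈ m := by
  let _ := Ideal.Quotient.field m
  obtain ⟨p, hp⟩ := CharP.exists (R ⧸ m)
  rcases CharP.char_is_prime_or_zero (R ⧸ m) p with h | rfl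
  · refine ⟨p, h, ?_⟩
    rw [← Ideal.Quotient.eq_zero_iff_mem, map_natCast]
    exact CharP.cast_eq_zero _ _
  · exfalso
    have := CharP.charP_to_charZero (R ⧸ m)
    -- In characteristic zero, the residue field contains `1/2`, which is not an integer.
    obtain ⟨y, hy⟩ := Ideal.Quotient.mk_surjective ((2 : R ⧸ m)⁻¹)
    obtain ⟨n, hn⟩ := hint _ (Ideal.Quotient.mk m) y
    rw [hy] at hn
    have h2 : ((2 * n : ℤ) : R ⧸ m) = ((1 : ℤ) : R ⧸ m) := by
      push_cast
      rw [← hn]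
      exact mul_inv_cancel₀ two_ne_zero
    have := Int.cast_injective h2
    omega

/-- Two integer valued characters of a ring in which `x ≡ x ^ p` modulo `p` are equal if they are
congruent modulo `p`. -/
theorem ringHom_eq_of_congr {R : Type*} [CommRing R] {p : ℕ} (hp : p.Prime)
    (hfrob : ∀ x : R, ∃ d, x = x ^ p + p * d) (φ ψ : R →+* ℤ)
    (h : ∀ x, (p : ℤ) ∣ φ x - ψ x) : φ = ψ := by
  have hp0 : (p : ℤ) ≠ 0 := Nat.cast_ne_zero.2 hp.ne_zero
  have key : ∀ k : ℕ, ∀ x, (p : ℤ) ^ (k + 1) ∣ φ x - ψ x := by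
    intro k
    induction k with
    | zero => simpa using h
    | succ k ih =>
      intro x
      obtain ⟨d, hd⟩ := hfrob x
      -- Raising to the power `p` improves a congruence modulo `p ^ (k + 1)` by one factor `p`; the
      -- other term `p * d` of `x` brings its own factor.
      have h1 : (p : ℤ) ^ (k + 2) ∣ φ x ^ p - ψ x ^ p := by
        obtain ⟨t, ht⟩ := ih x
        have hφ : φ x = ψ x + p ^ (k + 1) * t := by linarith
        obtain ⟨r, hr⟩ := exists_add_pow_prime_eq hp (ψ x) (p ^ (k + 1) * t)
        rw [hφ, hr]
        have h3 : (p : ℤ) ^ (k + 2) ∣ (p ^ (k + 1) * t) ^ p := by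
          rw [mul_pow, ← pow_mul]
          refine Dvd.dvd.mul_right (pow_dvd_pow _ ?_) _
          have := hp.two_le
          nlinarith
        have h4 : (p : ℤ) ^ (k + 2) ∣ p * ψ x * (p ^ (k + 1) * t) * r :=
          ⟨ψ x * t * r, by ring⟩
        have h5 : ψ x ^ p + ((p : ℤ) ^ (k + 1) * t) ^ p + p * ψ x * (p ^ (k + 1) * t) * r -
            ψ x ^ p = (p ^ (k + 1) * t) ^ p + p * ψ x * (p ^ (k + 1) * t) * r := by ring
        rw [h5]
        exact dvd_add h3 h4
      have h2 : (p : ℤ) ^ (k + 2) ∣ p * (φ d - ψ d) := by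
        rw [pow_succ' _ (k + 1)]
        exact mul_dvd_mul_left _ (ih d)
      have h6 : φ x - ψ x = (φ x ^ p - ψ x ^ p) + p * (φ d - ψ d) := by
        conv_lhs => rw [hd]
        simp only [map_add, map_mul, map_pow, map_natCast]
        ring
      rw [h6]
      exact dvd_add h1 h2
  ext x
  -- With `N = |φ x - ψ x|`, the exponent `N + 1` suffices, since `N < p ^ N`.
  refine sub_eq_zero.1 (Int.eq_zero_of_abs_lt_dvd (key (φ x - ψ x).natAbs x) ?_)
  have h8 := Nat.lt_pow_self (n := (φ x - ψ x).natAbs) hp.one_lt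
  have h9 := Nat.pow_le_pow_right hp.pos (Nat.le_succ (φ x - ψ x).natAbs)
  rw [Int.abs_eq_natAbs]
  exact_mod_cast h8.trans_le h9

/-- A torsion-free finitely generated ring in which `x ≡ x ^ p` modulo `p` for all primes `p`, and
all of whose characters of characteristic zero are integer valued, is a finite power of `ℤ`. -/
theorem exists_ringEquiv_pi_int {R : Type v} [CommRing R] [IsNoetherianRing R]
    (htf : ∀ (n : ℕ) (x : R), n ≠ 0 → n * x = 0 → x = 0)
    (hfrob : ∀ p : ℕ, p.Prime → ∀ x : R, ∃ d, x = x ^ p + p * d)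
    (hint : ∀ (K : Type v) [Field K] [CharZero K] (φ : R →+* K) (x : R), ∃ n : ℤ, φ x = n) :
    ∃ n : ℕ, Nonempty (R ≃+* (Fin n → ℤ)) := by
  classical
  -- For nilpotent `x`, iterating `x ≡ x ^ p` gives `x = p d`, and `d` is nilpotent by
  -- torsion-freeness. So the nilradical `N` satisfies `N = p N` for every prime `p`.
  have hnil : nilradical R = ⊥ := by
    have hfg : (nilradical R).FG := IsNoetherian.noetherian _
    have hdiv : ∀ p : ℕ, p.Prime → nilradical R ≤ Ideal.span {(p : R)} • nilradical R := by
      intro p hp x hx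
      rw [mem_nilradical] at hx
      obtain ⟨n, hn⟩ := hx
      have hdvd : ∀ k : ℕ, ∃ d, x = x ^ p ^ k + p * d := by
        intro k
        induction k with
        | zero => exact ⟨0, by simp⟩
        | succ k ih =>
          obtain ⟨d, hd⟩ := ih
          obtain ⟨e, he⟩ := hfrob p hp (x ^ p ^ k)
          refine ⟨e + d, ?_⟩
          rw [← pow_mul, ← pow_succ] at he
          linear_combination hd + he
      obtain ⟨d, hd⟩ := hdvd n
      have h0 : x ^ p ^ n = 0 :=
        pow_eq_zero_of_le (Nat.lt_pow_self hp.one_lt).le hn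
      rw [h0, zero_add] at hd
      have hd' : d ∈ nilradical R := by
        rw [mem_nilradical]
        refine ⟨n, htf (p ^ n) _ (pow_ne_zero _ hp.ne_zero) ?_⟩
        push_cast
        rw [← mul_pow, ← hd, hn]
      rw [hd]
      exact Submodule.smul_mem_smul (Ideal.mem_span_singleton_self _) hd'
    by_contra hne
    have hann : Module.annihilator R (nilradical R) ≠ ⊤ := by
      intro h
      apply hne
      rw [Module.annihilator_eq_top_iff] at h
      exact (Submodule.subsingleton_iff_eq_bot).1 h
    obtain ⟨m, hm, hle⟩ := Ideal.exists_le_maximal _ hann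
    obtain ⟨p, hp, hpm⟩ := exists_prime_mem_of_isMaximal hint m
    -- Nakayama: `r ≡ 1` modulo `p` kills `N`. Then `r` and `r - 1` both lie in `m`.
    obtain ⟨r, hr, hr0⟩ := exists_sub_one_mem_and_smul_eq_zero_of_fg_of_le_smul _ _ hfg (hdiv p hp)
    apply hm.ne_top
    rw [Ideal.eq_top_iff_one]
    have h1 : r ∈ m := hle (by
      rw [Module.mem_annihilator]
      intro y
      exact Subtype.ext (hr0 _ y.2))
    have h2 : r - 1 ∈ m := (Ideal.span_singleton_le_iff_mem _).2 hpm hr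
    simpa using sub_mem h1 h2
  -- A minimal prime consists of zero divisors, so it contains no nonzero integer and `R ⧸ P` has
  -- characteristic zero; the map to its fraction field is integer valued.
  have hchar : ∀ P : minimalPrimes R, ∃ ψ : R →+* ℤ, RingHom.ker ψ = P.1 := by
    rintro ⟨P, hP⟩
    have : P.IsPrime := hP.1.1
    have hdisj := Ideal.disjoint_nonZeroDivisors_of_mem_minimalPrimes hP
    have : CharZero (R ⧸ P) := by
      refine charZero_of_inj_zero fun n hn => ?_
      by_contra hn0
      rw [← map_natCast (Ideal.Quotient.mk P), Ideal.Quotient.eq_zero_iff_mem] at hn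
      refine Set.disjoint_left.1 hdisj hn ?_
      rw [SetLike.mem_coe, mem_nonZeroDivisors_iff_right]
      intro x hx
      exact htf n x hn0 (by rw [mul_comm]; exact hx)
    let f : R →+* FractionRing (R ⧸ P) := (algebraMap (R ⧸ P) _).comp (Ideal.Quotient.mk P)
    have : CharZero (FractionRing (R ⧸ P)) :=
      charZero_of_injective_algebraMap (IsFractionRing.injective (R ⧸ P) _)
    have hf : ∀ x, f x ∈ (Int.castRingHom (FractionRing (R ⧸ P))).range := fun x => by
      obtain ⟨n, hn⟩ := hint _ f x
      exact ⟨n, by simp [hn]⟩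
    have hinj : Function.Injective (Int.castRingHom (FractionRing (R ⧸ P))) := Int.cast_injective
    let e := RingEquiv.ofLeftInverse (f := Int.castRingHom (FractionRing (R ⧸ P)))
      (Function.leftInverse_invFun hinj)
    refine ⟨(e.symm : _ →+* ℤ).comp (f.codRestrict _ hf), ?_⟩
    ext x
    rw [RingHom.mem_ker, RingHom.comp_apply, RingHom.coe_coe, map_eq_zero_iff _ e.symm.injective,
      ← Subtype.coe_inj]
    change algebraMap (R ⧸ P) _ (Ideal.Quotient.mk P x) = 0 ↔ _
    rw [map_eq_zero_iff _ (IsFractionRing.injective (R ⧸ P) _), Ideal.Quotient.eq_zero_iff_mem]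
  choose ψ hψ using hchar
  have : Finite (minimalPrimes R) := (minimalPrimes.finite_of_isNoetherianRing R)
  -- If `P` and `Q` lie in a maximal ideal `m` over `p`, then `ψ P x ≡ x ≡ ψ Q x` modulo `m`. An
  -- integer in `m` is divisible by `p`, so the two characters agree modulo `p` and hence are equal.
  have hcop : Pairwise (Function.onFun IsCoprime fun P : minimalPrimes R => P.1) := by
    intro P Q hPQ
    rw [Function.onFun, Ideal.isCoprime_iff_sup_eq]
    by_contra hne
    obtain ⟨m, hm, hle⟩ := Ideal.exists_le_maximal _ hne
    obtain ⟨p, hp, hpm⟩ := exists_prime_mem_of_isMaximal hint m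
    apply hPQ
    have : ψ P = ψ Q := by
      refine ringHom_eq_of_congr hp (hfrob p hp) _ _ fun x => ?_
      have h1 : x - (ψ P x : R) ∈ m := hle (mem_sup_left (by rw [← hψ P, RingHom.mem_ker]; simp))
      have h2 : x - (ψ Q x : R) ∈ m := hle (mem_sup_right (by rw [← hψ Q, RingHom.mem_ker]; simp))
      have h3 : ((ψ P x - ψ Q x : ℤ) : R) ∈ m := by
        have := sub_mem h2 h1
        push_cast
        simpa using this
      by_contra hnd
      have hco : IsCoprime (p : ℤ) (ψ P x - ψ Q x) :=
        ((Nat.prime_iff_prime_int.1 hp).irreducible.coprime_iff_not_dvd).2 hnd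
      obtain ⟨a, b, hab⟩ := hco
      apply hm.ne_top
      rw [Ideal.eq_top_iff_one]
      have h4 := congrArg (Int.cast : ℤ → R) hab
      rw [Int.cast_one, Int.cast_add, Int.cast_mul, Int.cast_mul, Int.cast_natCast] at h4
      rw [← h4]
      exact add_mem (Ideal.mul_mem_left _ _ hpm) (Ideal.mul_mem_left _ _ h3)
    apply Subtype.ext
    rw [← hψ P, ← hψ Q, this]
  have hinf : (⨅ P : minimalPrimes R, P.1) = ⊥ := by
    rw [← hnil, nilradical, ← Ideal.sInf_minimalPrimes, sInf_eq_iInf']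
    rfl
  have hsurj : ∀ P, Function.Surjective (ψ P) := fun P n => ⟨n, by simp⟩
  obtain ⟨n, ⟨e⟩⟩ := Finite.exists_equiv_fin (minimalPrimes R)
  refine ⟨n, ⟨?_⟩⟩
  refine (RingEquiv.quotientBot R).symm.trans ((Ideal.quotEquivOfEq hinf.symm).trans
    ((Ideal.quotientInfRingEquivPiQuotient _ hcop).trans
      ((RingEquiv.piCongrRight fun P => (Ideal.quotEquivOfEq (hψ P).symm).trans
        (RingHom.quotientKerEquivOfSurjective (hsurj P))).trans ?_)))
  exact (RingEquiv.piCongrLeft (fun _ : Fin n => ℤ) e)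

/-- A torsion-free ring in which `x ≡ x ^ p` modulo `p` for all primes `p` is a finite power of `ℤ`,
if it is generated by a set `B` that spans a finitely generated group and such that `x` in `B`
satisfies `x ^ p - x = p x c` with `c` a combination of products of `p - 1` elements of `B`. -/
theorem exists_ringEquiv_pi_int_of_generators {R : Type v} [CommRing R] {B : Set R}
    (hfg : (AddSubgroup.closure B).FG) (hgen : Subring.closure B = ⊤)
    (hB : ∀ x ∈ B, ∀ p : ℕ, p.Prime → ∃ c ∈ spanPow B (p - 1), x ^ p - x = p * x * c)
    (htf : ∀ (n : ℕ) (x : R), n ≠ 0 → n * x = 0 → x = 0)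
    (hfrob : ∀ p : ℕ, p.Prime → ∀ x : R, ∃ d, x = x ^ p + p * d) :
    ∃ n : ℕ, Nonempty (R ≃+* (Fin n → ℤ)) := by
  have hfg' : (span ℤ B).FG := by
    rw [Submodule.fg_iff_addSubgroup_fg, Submodule.span_int_eq_addSubgroupClosure]
    exact hfg
  have hgen' := adjoin_eq_top_of_closure_eq_top hgen
  have hft : Algebra.FiniteType ℤ R := by
    obtain ⟨s, hs⟩ := hfg'
    refine ⟨⟨s, ?_⟩⟩
    rw [eq_top_iff, ← hgen']
    refine Algebra.adjoin_le fun x hx => Algebra.span_le_adjoin ℤ _ ?_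
    rw [hs]
    exact subset_span hx
  have := Algebra.FiniteType.isNoetherianRing ℤ R
  exact exists_ringEquiv_pi_int htf hfrob fun K _ _ φ x => map_eq_intCast hfg' hgen' hB φ x

/-- The number of factors `ℤ` is at most the number of homomorphisms to `ZMod 2` from a subgroup that
generates the ring. -/
theorem le_two_pow_finrank {R : Type*} [CommRing R] [m : Module ℤ R] {B : Set R}
    (hfg : (span ℤ B).FG) (hgen : Subring.closure B = ⊤) {n : ℕ} (φ : R ≃+* (Fin n → ℤ)) :
    n ≤ 2 ^ Module.finrank ℤ (span ℤ B) := by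
  obtain rfl : m = AddCommGroup.toIntModule R := Subsingleton.elim _ _
  have : Module.Finite ℤ (span ℤ B) := Module.Finite.iff_fg.2 hfg
  have : Module.IsTorsionFree ℤ R :=
    φ.injective.moduleIsTorsionFree _ fun n x => by simp
  let b := Module.finBasis ℤ (span ℤ B)
  let χ : Fin n → R →+* ZMod 2 := fun i =>
    ((Int.castRingHom (ZMod 2)).comp (Pi.evalRingHom _ i)).comp (φ : _ →+* (Fin n → ℤ))
  -- The characters modulo 2 are told apart by the idempotents of `ℤ ^ n`. Each is determined by its
  -- values on `B`, hence by those on the `r` basis vectors.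
  have hinj : Function.Injective fun i j => χ i (b j) := by
    intro i i' h
    have h1 : (χ i).toAddMonoidHom.toIntLinearMap.comp (span ℤ B).subtype =
        (χ i').toAddMonoidHom.toIntLinearMap.comp (span ℤ B).subtype :=
      b.ext fun j => congrFun h j
    have h2 : χ i = χ i' := RingHom.eq_of_eqOn_set_dense hgen fun x hx =>
      LinearMap.congr_fun h1 ⟨x, subset_span hx⟩
    by_contra hne
    have h3 := RingHom.congr_fun h2 (φ.symm (Pi.single i 1))
    have h4 : ((φ (φ.symm (Pi.single i 1)) i : ℤ) : ZMod 2) =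
      ((φ (φ.symm (Pi.single i 1)) i' : ℤ) : ZMod 2) := h3
    rw [φ.apply_symm_apply, Pi.single_eq_same, Pi.single_eq_of_ne (Ne.symm hne)] at h4
    simp at h4
  simpa using Fintype.card_le_of_injective _ hinj

end BinomialAlgebra

open MulAction

/-! ### Smooth actions: closure properties and absence of finite cycles. -/

section SmoothClass

/-- The smoothness conditions on a `G`-set `T`, as a property of the action on `T`. -/
class Smooth (G Ω T : Type u) [Group G] [MulAction G Ω] [MulAction G T] : Prop where
  finitary : Finite (orbitRel.Quotient G T)
  stabilizer_mem : ∀ t : T, stabilizer G t ∈ stabClass G Ω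

/-- The action of `G` on `X` has exactly one orbit. -/
class Trans (G X : Type u) [Group G] [MulAction G X] : Prop where
  nonempty : Nonempty X
  pretransitive : IsPretransitive G X

/-- An oligomorphic group such that setwise stabilizers of finite sets are pointwise stabilizers. -/
class Tame (G Ω : Type u) [Group G] [MulAction G Ω] : Prop where
  oligomorphic : IsOligomorphic G Ω
  stabilizer_le : ∀ A : Finset Ω, stabilizer G (A : Set Ω) ≤ fixingSubgroup G (A : Set Ω)

variable {G Ω : Type u} [Group G] [MulAction G Ω]

instance (X : SmoothSet G (stabClass G Ω)) : Smooth G Ω X := ⟨X.finitary, X.stabilizer_mem⟩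

theorem SmoothSet.IsTransitive.trans {E : Set (Subgroup G)} {X : SmoothSet G E}
    (h : X.IsTransitive) : Trans G X := ⟨h.1, h.2⟩

theorem Trans.exists_smul_eq {X : Type u} [MulAction G X] [h : Trans G X] (x y : X) :
    ∃ g : G, g • x = y := h.pretransitive.exists_smul_eq x y

theorem finite_orbits_of_separating {T : Type u} [MulAction G T] {F : Type*} [Finite F]
    (φ : T → F) (h : ∀ t t', φ t = φ t' → ∃ g : G, g • t = t') :
    Finite (orbitRel.Quotient G T) := by
  refine Finite.of_injective (fun q : orbitRel.Quotient G T => φ q.out) fun q q' hq => ?_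
  obtain ⟨g, hg⟩ := h _ _ hq
  rw [← Quotient.out_eq q, ← Quotient.out_eq q']
  exact (Quotient.sound (show orbitRel G T _ _ from ⟨g, hg⟩)).symm

theorem finite_orbits_of_surjective {T T' : Type u} [MulAction G T] [MulAction G T']
    [Finite (orbitRel.Quotient G T)] (φ : T →[G] T') (h : Function.Surjective φ) :
    Finite (orbitRel.Quotient G T') := by
  refine finite_orbits_of_separating
    (fun t => (Quotient.mk'' (Function.surjInv h t) : orbitRel.Quotient G T)) fun t t' ht => ?_
  obtain ⟨g, hg⟩ := (Quotient.exact ht.symm : orbitRel G T _ _)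
  refine ⟨g, ?_⟩
  dsimp only at hg
  rw [← Function.surjInv_eq h t, ← map_smul, hg, Function.surjInv_eq h t']

theorem stabilizer_map_of_injective {T T' : Type u} [MulAction G T] [MulAction G T']
    (φ : T →[G] T') (h : Function.Injective φ) (t : T) : stabilizer G (φ t) = stabilizer G t := by
  ext g
  rw [mem_stabilizer_iff, mem_stabilizer_iff, ← map_smul, h.eq_iff]

theorem stabilizer_le_map {T T' : Type u} [MulAction G T] [MulAction G T']
    (φ : T →[G] T') (t : T) : stabilizer G t ≤ stabilizer G (φ t) := by
  intro g hg
  rw [mem_stabilizer_iff] at hg ⊢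
  rw [← map_smul, hg]

theorem Smooth.of_injective {T T' : Type u} [MulAction G T] [MulAction G T'] [Smooth G Ω T']
    (φ : T →[G] T') (h : Function.Injective φ) : Smooth G Ω T where
  finitary := by
    have := Smooth.finitary (G := G) (Ω := Ω) (T := T')
    refine finite_orbits_of_separating
      (fun t => (Quotient.mk'' (φ t) : orbitRel.Quotient G T')) fun t t' ht => ?_
    obtain ⟨g, hg⟩ := (Quotient.exact ht.symm : orbitRel G T' _ _)
    exact ⟨g, h (by rw [map_smul]; exact hg)⟩
  stabilizer_mem t := by
    rw [← stabilizer_map_of_injective φ h]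
    exact Smooth.stabilizer_mem _

instance {T : Type u} [MulAction G T] [Smooth G Ω T] (S : SubMulAction G T) : Smooth G Ω S :=
  Smooth.of_injective S.inclusion Subtype.val_injective

theorem Tame.finite_orbits_pi [Tame G Ω] (κ : Type*) [Finite κ] :
    Finite (orbitRel.Quotient G (κ → Ω)) := by
  obtain ⟨n, ⟨e⟩⟩ := Finite.exists_equiv_fin κ
  have := Tame.oligomorphic (G := G) (Ω := Ω) n
  refine Finite.of_injective (fun q : orbitRel.Quotient G (κ → Ω) =>
    (Quotient.mk'' (fun i => q.out (e.symm i)) : orbitRel.Quotient G (Fin n → Ω))) fun q q' hq => ?_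
  obtain ⟨g, hg⟩ := (Quotient.exact hq.symm : orbitRel G (Fin n → Ω) _ _)
  rw [← Quotient.out_eq q, ← Quotient.out_eq q']
  refine (Quotient.sound (show orbitRel G (κ → Ω) _ _ from ⟨g, ?_⟩)).symm
  funext k
  simpa using congrFun hg (e k)

theorem stabClass_iInf {ι : Type*} [Finite ι] {S : ι → Subgroup G}
    (h : ∀ i, S i ∈ stabClass G Ω) : (⨅ i, S i) ∈ stabClass G Ω := by
  classical
  have := Fintype.ofFinite ι
  choose A hA using h
  refine ⟨Finset.univ.biUnion A, ?_⟩
  ext g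
  simp only [Subgroup.mem_iInf, hA, mem_fixingSubgroup_iff, Finset.coe_biUnion, Set.mem_iUnion]
  constructor
  · rintro h y ⟨i, _, hi⟩
    exact h i y hi
  · intro h i y hi
    exact h y ⟨i, Finset.mem_coe.2 (Finset.mem_univ i), hi⟩

theorem stabilizer_pi {ι : Type*} {T : Type*} [MulAction G T] (y : ι → T) :
    stabilizer G y = ⨅ i, stabilizer G (y i) := by
  ext g
  simp [Subgroup.mem_iInf, mem_stabilizer_iff, funext_iff]

/-- Each orbit of `T` has a representative with stabilizer `G(A)`, and `γ t` carries the
representative to `t`. The orbit of a tuple `y` is determined by the orbits of its entries and by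
the orbit of the family of translates `γ (y i) • a`, `a ∈ A`. That family is a tuple of points of
`Ω`, so oligomorphy leaves finitely many cases. -/
instance {ι : Type} [Finite ι] {T : Type u} [MulAction G T] [Smooth G Ω T] [Tame G Ω] :
    Smooth G Ω (ι → T) where
  finitary := by
    have := Smooth.finitary (G := G) (Ω := Ω) (T := T)
    choose A hA using Smooth.stabilizer_mem (G := G) (Ω := Ω) (T := T)
    have hrep : ∀ t : T, ∃ g : G, g • (Quotient.mk'' t : orbitRel.Quotient G T).out = t :=
      fun t => (orbitRel G T).symm (Quotient.mk_out (s := orbitRel G T) t)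
    choose γ hγ using hrep
    have hfin := fun w : ι → orbitRel.Quotient G T =>
      Tame.finite_orbits_pi (G := G) (Ω := Ω) (Σ i, A (w i).out)
    let w : (ι → T) → (ι → orbitRel.Quotient G T) := fun y i => Quotient.mk'' (y i)
    refine finite_orbits_of_separating (F := Σ w : ι → orbitRel.Quotient G T,
      orbitRel.Quotient G ((Σ i, A (w i).out) → Ω))
      (fun y => ⟨w y, Quotient.mk'' fun k => γ (y k.1) • (k.2 : Ω)⟩) fun y y' h => ?_
    obtain ⟨h1, h2⟩ := Sigma.mk.inj_iff.1 h
    have h3 : ∃ g : G, ∀ i, ∀ a ∈ A (w y i).out, g • γ (y i) • a = γ (y' i) • a := by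
      have key : ∀ w' (hw : w y = w'), (HEq (Quotient.mk'' (fun k => γ (y k.1) • (k.2 : Ω)) :
          orbitRel.Quotient G ((Σ i, A (w y i).out) → Ω))
          (Quotient.mk'' (fun k => γ (y' k.1) • (k.2 : Ω)) :
          orbitRel.Quotient G ((Σ i, A (w' i).out) → Ω))) →
          ∃ g : G, ∀ i, ∀ a ∈ A (w y i).out, g • γ (y i) • a = γ (y' i) • a := by
        rintro _ rfl hh
        obtain ⟨g, hg⟩ := (Quotient.exact (eq_of_heq hh).symm : orbitRel G _ _ _)
        exact ⟨g, fun i a ha => congrFun hg ⟨i, ⟨a, ha⟩⟩⟩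
      exact key _ h1 h2
    obtain ⟨g, hg⟩ := h3
    refine ⟨g, funext fun i => ?_⟩
    have hst : (γ (y' i))⁻¹ * g * γ (y i) ∈ stabilizer G (w y i).out := by
      rw [hA, mem_fixingSubgroup_iff]
      intro a ha
      rw [mul_smul, mul_smul, inv_smul_eq_iff]
      exact hg i a ha
    rw [mem_stabilizer_iff, mul_smul, mul_smul, inv_smul_eq_iff] at hst
    have e1 : γ (y i) • (w y i).out = y i := hγ (y i)
    have e2 : γ (y' i) • (w y i).out = y' i := by rw [h1]; exact hγ (y' i)
    rw [e1, e2] at hst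
    exact hst
  stabilizer_mem y := by
    rw [stabilizer_pi]
    exact stabClass_iInf fun i => Smooth.stabilizer_mem _

instance {T T' : Type u} [MulAction G T] [MulAction G T'] [hT : Smooth G Ω T]
    [hT' : Smooth G Ω T'] : Smooth G Ω (T ⊕ T') where
  finitary := by
    have := hT.finitary
    have := hT'.finitary
    refine finite_orbits_of_separating (F := orbitRel.Quotient G T ⊕ orbitRel.Quotient G T')
      (Sum.map Quotient.mk'' Quotient.mk'') fun t t' h => ?_
    rcases t with t | t <;> rcases t' with t' | t' <;> simp only [Sum.map_inl, Sum.map_inr,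
      reduceCtorEq, Sum.inl.injEq, Sum.inr.injEq] at h
    all_goals
      obtain ⟨g, hg⟩ := Quotient.exact h.symm
      exact ⟨g, by simpa using hg⟩
  stabilizer_mem t := by
    rcases t with t | t
    · convert hT.stabilizer_mem t using 1
      ext g; simp [mem_stabilizer_iff]
    · convert hT'.stabilizer_mem t using 1
      ext g; simp [mem_stabilizer_iff]

/-- A product embeds into a power of the disjoint union. -/
instance {T T' : Type u} [MulAction G T] [MulAction G T'] [Smooth G Ω T]
    [Smooth G Ω T'] [Tame G Ω] : Smooth G Ω (T × T') :=
  Smooth.of_injective (T' := Bool → T ⊕ T')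
    { toFun := fun t b => if b then Sum.inl t.1 else Sum.inr t.2
      map_smul' := fun g t => by funext b; cases b <;> rfl }
    (fun t t' h => by
      have h1 := congrFun h true
      have h2 := congrFun h false
      exact Prod.ext (Sum.inl.inj h1) (Sum.inr.inj h2))

/-- No group element has a nontrivial finite cycle on a smooth set. -/
theorem smul_eq_of_pow_smul_eq [Tame G Ω] {T : Type u} [MulAction G T] (hT : Smooth G Ω T) {g : G}
    {t : T} {k : ℕ} (hk : 0 < k) (h : g ^ k • t = t) : g • t = t := by
  classical
  obtain ⟨A, hA⟩ := hT.stabilizer_mem t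
  have hgA : ∀ a ∈ A, g ^ k • a = a := by
    have : g ^ k ∈ stabilizer G t := h
    rw [hA, mem_fixingSubgroup_iff] at this
    exact this
  -- `B` is the union of the translates of `A` by `1, g, ..., g ^ (k - 1)`. It is stable under `g`
  -- because `g ^ k` fixes `A` pointwise; so `g` fixes `B`, and in particular `A`, pointwise.
  let B : Finset Ω := (Finset.range k).biUnion fun i => A.image fun a => g ^ i • a
  have hB : g ∈ stabilizer G (B : Set Ω) := by
    rw [stabilizer_coe_finset, mem_stabilizer_finset']
    intro b hb
    simp only [B, Finset.mem_biUnion, Finset.mem_range, Finset.mem_image] at hb ⊢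
    obtain ⟨i, hi, a, ha, rfl⟩ := hb
    rcases (Nat.succ_le_of_lt hi).lt_or_eq with h1 | h1
    · exact ⟨i + 1, h1, a, ha, by rw [pow_succ', mul_smul]⟩
    · refine ⟨0, hk, a, ha, ?_⟩
      rw [pow_zero, one_smul, ← mul_smul, ← pow_succ', ← Nat.succ_eq_add_one, h1, hgA a ha]
  have := Tame.stabilizer_le B hB
  rw [mem_fixingSubgroup_iff] at this
  rw [← mem_stabilizer_iff, hA, mem_fixingSubgroup_iff]
  intro a ha
  refine this a ?_
  simp only [B, Finset.coe_biUnion, Set.mem_iUnion, Finset.coe_image]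
  exact ⟨0, Finset.mem_coe.2 (Finset.mem_range.2 hk), a, ha, by simp⟩

end SmoothClass

/-! ### Calculus of classes: sums over orbits, compositions, fiber powers. -/

section Classes

variable {G : Type u} (Ω : Type u) [Group G] [MulAction G Ω]

/-- A smooth `G`-set, bundled. -/
abbrev toSmoothSet (T : Type u) [MulAction G T] [h : Smooth G Ω T] :
    SmoothSet G (stabClass G Ω) := ⟨T, h.finitary, h.stabilizer_mem⟩

variable {T T' X X' Y Y' Z Z' O : Type u} [MulAction G T] [MulAction G T'] [MulAction G X]
  [MulAction G X'] [MulAction G Y] [MulAction G Y'] [MulAction G Z] [MulAction G Z'] [MulAction G O]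

theorem isTransitive_toSmoothSet [Smooth G Ω X] [h : Trans G X] :
    (toSmoothSet (G := G) Ω X).IsTransitive := ⟨h.1, h.2⟩

/-- The class of a map of smooth `G`-sets with transitive target. -/
noncomputable def cls [Smooth G Ω T] [Smooth G Ω X] [h : Trans G X] (f : T →[G] X) :
    Theta G (stabClass G Ω) :=
  Mor.cls ⟨toSmoothSet Ω T, toSmoothSet Ω X, f, h.1, h.2⟩

/-- The square with `f' : Y' → X'`, `f : Y → X`, `h : Y' → Y`, `k : X' → X` is cartesian. -/
def Cart (f' : Y' →[G] X') (f : Y →[G] X) (h : Y' →[G] Y) (k : X' →[G] X) : Prop :=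
  (∀ y', f (h y') = k (f' y')) ∧
    ∀ (y : Y) (x' : X'), f y = k x' → ∃! y' : Y', h y' = y ∧ f' y' = x'

theorem Cart.paste {f'' : Z' →[G] Z} {f' : Y' →[G] X'} {f : Y →[G] X} {h : Y' →[G] Y}
    {k : X' →[G] X} {h' : Z' →[G] Y'} {k' : Z →[G] X'} (H : Cart f' f h k)
    (H' : Cart f'' f' h' k') : Cart f'' f (h.comp h') (k.comp k') := by
  refine ⟨fun z => ?_, fun y z hyz => ?_⟩
  · simp only [MulActionHom.comp_apply]
    rw [H.1, H'.1]
  · obtain ⟨y', ⟨h1, h2⟩, h3⟩ := H.2 y (k' z) hyz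
    obtain ⟨z', ⟨h4, h5⟩, h6⟩ := H'.2 y' z h2
    refine ⟨z', ⟨by simp [h4, h1], h5⟩, fun w hw => h6 w ⟨h3 _ ⟨hw.1, ?_⟩, hw.2⟩⟩
    rw [H'.1, hw.2]

theorem Cart.of_bijective {e : Y' →[G] Y} (he : Function.Bijective e) {k : X' →[G] X}
    (hk : Function.Bijective k) {f' : Y' →[G] X'} {f : Y →[G] X}
    (hc : ∀ y', f (e y') = k (f' y')) : Cart f' f e k := by
  refine ⟨hc, fun y x' h => ?_⟩
  obtain ⟨y', rfl⟩ := he.2 y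
  refine ⟨y', ⟨rfl, hk.1 ?_⟩, fun w hw => he.1 hw.1⟩
  rw [← hc, h]

theorem mk_eq_zero_of_rel {E : Set (Subgroup G)} {q : MvPolynomial (Mor G E) ℤ} (h : Rel q) :
    (Ideal.Quotient.mk (Ideal.span {p : MvPolynomial (Mor G E) ℤ | Rel p}) q) = 0 :=
  Ideal.Quotient.eq_zero_iff_mem.2 (Ideal.subset_span h)

variable [Smooth G Ω T] [Smooth G Ω T'] [Smooth G Ω X] [Smooth G Ω X'] [Smooth G Ω Y]
  [Smooth G Ω Y'] [Smooth G Ω Z] [Smooth G Ω Z'] [Smooth G Ω O]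

theorem cls_eq_one [Trans G X] {f : Y →[G] X} (hf : Function.Bijective f) : cls Ω f = 1 := by
  have h := mk_eq_zero_of_rel (Rel.iso (Y := toSmoothSet Ω Y) (isTransitive_toSmoothSet Ω) f hf)
  rw [map_sub, sub_eq_zero, map_one] at h
  exact h

theorem cls_add [Trans G X] (f : Y →[G] X) (i : T →[G] Y) (j : T' →[G] Y)
    (h : Function.Bijective (Sum.elim i j)) :
    cls Ω f = cls Ω (f.comp i) + cls Ω (f.comp j) := by
  have h := mk_eq_zero_of_rel (Rel.add (Y := toSmoothSet Ω Y) (Y₁ := toSmoothSet Ω T)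
    (Y₂ := toSmoothSet Ω T') (isTransitive_toSmoothSet Ω) f i j h)
  rw [map_sub, sub_eq_zero, map_add] at h
  exact h

theorem cls_comp_of_trans [hZ : Trans G Z] [Trans G Y] [Trans G X] (f : Y →[G] X) (g : Z →[G] Y) :
    cls Ω (f.comp g) = cls Ω f * cls Ω g := by
  have h := mk_eq_zero_of_rel (Rel.comp (isTransitive_toSmoothSet Ω (X := Z))
    (isTransitive_toSmoothSet Ω (X := Y)) (isTransitive_toSmoothSet Ω (X := X)) f g)
  rw [map_sub, sub_eq_zero, map_mul] at h
  exact h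

theorem cls_eq_of_cart [Trans G X] [Trans G X'] {f' : Y' →[G] X'} {f : Y →[G] X} {h : Y' →[G] Y}
    {k : X' →[G] X} (H : Cart f' f h k) : cls Ω f' = cls Ω f := by
  have h := mk_eq_zero_of_rel (Rel.baseChange (Y := toSmoothSet Ω Y) (Y' := toSmoothSet Ω Y')
    (isTransitive_toSmoothSet Ω (X := X)) (isTransitive_toSmoothSet Ω (X := X')) f' f h k H)
  rw [map_sub, sub_eq_zero] at h
  exact h.symm

theorem cls_comp_bijective [Trans G X] (f : Y →[G] X) {e : Y' →[G] Y} (he : Function.Bijective e) :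
    cls Ω (f.comp e) = cls Ω f :=
  cls_eq_of_cart Ω (Cart.of_bijective he (k := MulActionHom.id G) Function.bijective_id
    fun _ => rfl)

/-- The empty set is the disjoint union of two copies of itself. -/
theorem cls_of_isEmpty [Trans G X] [IsEmpty Y] (f : Y →[G] X) : cls Ω f = 0 := by
  have h := cls_add Ω f (MulActionHom.id G) (MulActionHom.id G)
    ⟨fun a => by rcases a with a | a <;> exact isEmptyElim a, fun a => isEmptyElim a⟩
  have h2 : f.comp (MulActionHom.id G) = f := rfl
  rw [h2] at h
  simpa using h

/-- The invariant subset where an invariant predicate holds. -/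
def invSub (P : T → Prop) (hP : ∀ (g : G) t, P t → P (g • t)) : SubMulAction G T where
  carrier := {t | P t}
  smul_mem' g _ ht := hP g _ ht

/-- The fiber of an invariant map. -/
def fiberSub {ι : Type*} (c : T → ι) (hc : ∀ (g : G) t, c (g • t) = c t) (i : ι) :
    SubMulAction G T where
  carrier := {t | c t = i}
  smul_mem' g _ ht := (hc g _).trans ht

theorem cls_eq_sum [Trans G X] (f : T →[G] X) {ι : Type*} [Fintype ι] (c : T → ι)
    (hc : ∀ (g : G) t, c (g • t) = c t) :
    cls Ω f = ∑ i, cls Ω (f.comp (fiberSub c hc i).inclusion) := by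
  classical
  have key : ∀ s : Finset ι, cls Ω (f.comp (invSub (fun t => c t ∈ s)
      (fun g t h => by rw [hc]; exact h)).inclusion) =
      ∑ i ∈ s, cls Ω (f.comp (fiberSub c hc i).inclusion) := by
    intro s
    induction s using Finset.induction_on with
    | empty =>
      rw [Finset.sum_empty]
      have : IsEmpty (invSub (fun t => c t ∈ (∅ : Finset ι))
          (fun (g : G) t h => by rw [hc]; exact h)) := ⟨fun t => Finset.notMem_empty _ t.2⟩
      exact cls_of_isEmpty Ω _
    | insert a s ha ih =>
      rw [Finset.sum_insert ha, ← ih]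
      let S := invSub (fun t => c t ∈ insert a s) (fun (g : G) t h => by rw [hc]; exact h)
      let i : fiberSub c hc a →[G] S :=
        { toFun := fun t => ⟨t.1, Finset.mem_insert.2 (Or.inl t.2)⟩
          map_smul' := fun _ _ => rfl }
      let j : invSub (fun t => c t ∈ s) (fun (g : G) t h => by rw [hc]; exact h) →[G] S :=
        { toFun := fun t => ⟨t.1, Finset.mem_insert.2 (Or.inr t.2)⟩
          map_smul' := fun _ _ => rfl }
      refine cls_add Ω (f.comp S.inclusion) i j ⟨?_, ?_⟩
      · rintro (⟨t, ht⟩ | ⟨t, ht⟩) (⟨t', ht'⟩ | ⟨t', ht'⟩) h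
        · have : t = t' := congrArg (fun z : S => z.1) h
          subst this; rfl
        · have : t = t' := congrArg (fun z : S => z.1) h
          subst this
          exact absurd ((show c t = a from ht) ▸ (show c t ∈ s from ht')) ha
        · have : t = t' := congrArg (fun z : S => z.1) h
          subst this
          exact absurd ((show c t = a from ht') ▸ (show c t ∈ s from ht)) ha
        · have : t = t' := congrArg (fun z : S => z.1) h
          subst this; rfl
      · rintro ⟨t, ht⟩
        rcases Finset.mem_insert.1 ht with h | h
        · exact ⟨Sum.inl ⟨t, h⟩, rfl⟩
        · exact ⟨Sum.inr ⟨t, h⟩, rfl⟩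
  rw [← key Finset.univ]
  refine (cls_comp_bijective Ω f ⟨Subtype.val_injective, fun t => ⟨⟨t, Finset.mem_univ _⟩, rfl⟩⟩).symm

/-- The map to the set of orbits. -/
def orbMk (t : T) : orbitRel.Quotient G T := Quotient.mk'' t

theorem orbMk_smul (g : G) (t : T) : orbMk (G := G) (g • t) = orbMk t :=
  Quotient.sound (show orbitRel G T _ _ from ⟨g, rfl⟩)

instance trans_fiberSub_orbMk (q : orbitRel.Quotient G T) :
    Trans G (fiberSub (orbMk (G := G) (T := T)) orbMk_smul q) where
  nonempty := ⟨⟨q.out, Quotient.out_eq q⟩⟩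
  pretransitive := ⟨by
    rintro ⟨t, ht⟩ ⟨t', ht'⟩
    have h : orbMk (G := G) t' = orbMk t := Eq.trans ht' (Eq.symm ht)
    obtain ⟨g, hg⟩ := (Quotient.exact h : orbitRel G T _ _)
    exact ⟨g, Subtype.ext hg⟩⟩

/-- Splitting `Z` into orbits removes the requirement that `Z` be transitive. -/
theorem cls_comp [Trans G Y] [Trans G X] (f : Y →[G] X) (g : Z →[G] Y) :
    cls Ω (f.comp g) = cls Ω f * cls Ω g := by
  have := Smooth.finitary (G := G) (Ω := Ω) (T := Z)
  have := Fintype.ofFinite (orbitRel.Quotient G Z)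
  rw [cls_eq_sum Ω (f.comp g) orbMk orbMk_smul, cls_eq_sum Ω g orbMk orbMk_smul, Finset.mul_sum]
  refine Finset.sum_congr rfl fun q _ => ?_
  rw [← cls_comp_of_trans Ω f (g.comp (fiberSub orbMk orbMk_smul q).inclusion)]
  rfl

/-- A map all of whose base changes to transitive sets have class `v`. -/
def HasCls (f : Y →[G] X) (v : Theta G (stabClass G Ω)) : Prop :=
  ∀ (O Z : Type u) [MulAction G O] [MulAction G Z] [Smooth G Ω O] [Smooth G Ω Z] [Trans G O]
    (f' : Z →[G] O) (h : Z →[G] Y) (k : O →[G] X), Cart f' f h k → cls Ω f' = v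

theorem hasCls_cls [Trans G X] (f : Y →[G] X) : HasCls Ω f (cls Ω f) :=
  fun _ _ _ _ _ _ _ _ _ _ h => cls_eq_of_cart Ω h

variable {Ω}

theorem HasCls.baseChange {f' : Y' →[G] X'} {f : Y →[G] X} {h : Y' →[G] Y} {k : X' →[G] X}
    {v : Theta G (stabClass G Ω)} (hf : HasCls Ω f v) (H : Cart f' f h k) : HasCls Ω f' v :=
  fun O Z _ _ _ _ _ _ _ _ H' => hf O Z _ _ _ (H.paste H')

/-- Multiplicativity survives for an intransitive middle set, if `g` has the same class `v` over
every orbit: sum over the orbits of `Y`. -/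
theorem HasCls.cls_comp [Trans G X] {g : Z →[G] Y} {v : Theta G (stabClass G Ω)}
    (hg : HasCls Ω g v) (f : Y →[G] X) : cls Ω (f.comp g) = cls Ω f * v := by
  have := Smooth.finitary (G := G) (Ω := Ω) (T := Y)
  have := Fintype.ofFinite (orbitRel.Quotient G Y)
  have hc : ∀ (γ : G) z, orbMk (G := G) (g (γ • z)) = orbMk (g z) := fun γ z => by
    rw [map_smul, orbMk_smul]
  rw [cls_eq_sum Ω (f.comp g) (fun z => orbMk (g z)) hc, cls_eq_sum Ω f orbMk orbMk_smul,
    Finset.sum_mul]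
  refine Finset.sum_congr rfl fun q _ => ?_
  let g' : fiberSub (fun z => orbMk (G := G) (g z)) hc q →[G]
      fiberSub (orbMk (G := G) (T := Y)) orbMk_smul q :=
    { toFun := fun z => ⟨g z.1, z.2⟩
      map_smul' := fun γ z => Subtype.ext (map_smul g γ z.1) }
  have hcart : Cart g' g (SubMulAction.inclusion _) (SubMulAction.inclusion _) := by
    refine ⟨fun _ => rfl, ?_⟩
    rintro z ⟨y, hy⟩ h
    change g z = y at h
    subst h
    exact ⟨⟨z, hy⟩, ⟨rfl, rfl⟩, fun w hw => Subtype.ext hw.1⟩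
  rw [← hg _ _ g' _ _ hcart, ← Oligo.cls_comp]
  rfl

/-- The fiber product of `g : Z → Y` and `k : X → Y`. -/
def pullback (g : Z →[G] Y) (k : X →[G] Y) : SubMulAction G (Z × X) :=
  invSub (fun t => g t.1 = k t.2) fun γ t h => by
    rw [Prod.smul_fst, Prod.smul_snd, map_smul, map_smul, h]

/-- The second projection from a set of pairs. -/
def sndHom (W : SubMulAction G (Z × X)) : W →[G] X where
  toFun t := t.1.2
  map_smul' _ _ := rfl

/-- The first projection from a set of pairs. -/
def fstHom (W : SubMulAction G (Z × X)) : W →[G] Z where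
  toFun t := t.1.1
  map_smul' _ _ := rfl

theorem cart_pullback (g : Z →[G] Y) (k : X →[G] Y) :
    Cart (sndHom (pullback g k)) g (fstHom (pullback g k)) k :=
  ⟨fun t => t.2, fun z x h => ⟨⟨(z, x), h⟩, ⟨rfl, rfl⟩, fun _ hw =>
    Subtype.ext (Prod.ext hw.1 hw.2)⟩⟩

/-- The set of families of points of `Z` over the same point of `X`, the `i`-th one in `W i`. -/
def piSub {ι : Type} (W : ι → SubMulAction G (Z × X)) : SubMulAction G ((ι → Z) × X) :=
  invSub (fun t => ∀ i, (t.1 i, t.2) ∈ W i) fun γ _ h i => (W i).smul_mem γ (h i)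

theorem piSub_ext {ι : Type} {W : ι → SubMulAction G (Z × X)} {a b : piSub W}
    (h1 : a.1.1 = b.1.1) (h2 : a.1.2 = b.1.2) : a = b := Subtype.ext (Prod.ext h1 h2)

/-- Forgetting the point in `W 0` is a base change of `W 0 → X`, so each factor contributes its own
class. -/
theorem cls_piSub_fin [Tame G Ω] [Trans G X] {n : ℕ} (W : Fin n → SubMulAction G (Z × X)) :
    cls Ω (sndHom (piSub W)) = ∏ i, cls Ω (sndHom (W i)) := by
  induction n with
  | zero =>
    rw [Finset.univ_eq_empty, Finset.prod_empty]
    refine cls_eq_one Ω ⟨?_, fun x => ⟨⟨(Fin.elim0, x), fun i => i.elim0⟩, rfl⟩⟩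
    rintro ⟨⟨z, x⟩, h⟩ ⟨⟨z', x'⟩, h'⟩ hx
    exact Subtype.ext (Prod.ext (Subsingleton.elim _ _) hx)
  | succ n ih =>
    rw [Fin.prod_univ_succ, ← ih, mul_comm]
    let t : piSub W →[G] piSub (fun i : Fin n => W i.succ) :=
      { toFun := fun e => ⟨(fun i => e.1.1 i.succ, e.1.2), fun i => e.2 i.succ⟩
        map_smul' := fun _ _ => rfl }
    let h : piSub W →[G] W 0 :=
      { toFun := fun e => ⟨(e.1.1 0, e.1.2), e.2 0⟩
        map_smul' := fun _ _ => rfl }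
    have hcart : Cart t (sndHom (W 0)) h (sndHom _) := by
      refine ⟨fun _ => rfl, ?_⟩
      rintro ⟨⟨z, x⟩, hz⟩ ⟨⟨w, x'⟩, hw⟩ hx
      change x = x' at hx
      subst hx
      refine ⟨⟨(Fin.cons z w, x), fun i => ?_⟩, ⟨rfl, rfl⟩, ?_⟩
      · refine Fin.cases ?_ (fun i => ?_) i
        · exact hz
        · exact hw i
      · rintro ⟨⟨v, y⟩, hv⟩ ⟨h1, h2⟩
        have h1 := congrArg (fun t : W 0 => t.1) h1
        have h2 := congrArg (fun t : piSub (fun i : Fin n => W i.succ) => t.1) h2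
        have h1a : v 0 = z := congrArg Prod.fst h1
        have h1b : y = x := congrArg Prod.snd h1
        have h2a : (fun i : Fin n => v i.succ) = w := congrArg Prod.fst h2
        refine Subtype.ext (Prod.ext ?_ h1b)
        funext i
        refine Fin.cases h1a (fun i => congrFun h2a i) i
    exact ((hasCls_cls Ω (sndHom (W 0))).baseChange hcart).cls_comp (sndHom _)

theorem cls_piSub [Tame G Ω] [Trans G X] {ι : Type} [Fintype ι]
    (W : ι → SubMulAction G (Z × X)) :
    cls Ω (sndHom (piSub W)) = ∏ i, cls Ω (sndHom (W i)) := by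
  let e := Fintype.equivFin ι
  rw [← Equiv.prod_comp e.symm, ← cls_piSub_fin (fun i => W (e.symm i))]
  let h : piSub W →[G] piSub (fun i => W (e.symm i)) :=
    { toFun := fun t => ⟨(fun i => t.1.1 (e.symm i), t.1.2), fun i => t.2 _⟩
      map_smul' := fun _ _ => rfl }
  have hh : Function.Bijective h := by
    constructor
    · intro a b hab
      have h1 : (h a).1.1 = (h b).1.1 := by rw [hab]
      have h2 : (h a).1.2 = (h b).1.2 := by rw [hab]
      refine piSub_ext (funext fun i => ?_) h2
      have : a.1.1 (e.symm (e i)) = b.1.1 (e.symm (e i)) := congrFun h1 (e i)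
      rwa [e.symm_apply_apply] at this
    · intro b
      refine ⟨⟨(fun i => b.1.1 (e i), b.1.2), fun i => ?_⟩, piSub_ext (funext fun i => ?_) rfl⟩
      · have := b.2 (e i)
        simpa using this
      · exact congrArg b.1.1 (e.apply_symm_apply i)
  rw [← cls_comp_bijective Ω (sndHom (piSub fun i => W (e.symm i))) hh]
  rfl

theorem exists_hom_of_stabilizer_le [hO : Trans G O] (o : O) (t : T)
    (h : stabilizer G o ≤ stabilizer G t) : ∃ s : O →[G] T, s o = t := by
  choose γ hγ using fun o' : O => hO.exists_smul_eq o o'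
  have key : ∀ g g' : G, g • o = g' • o → g • t = g' • t := by
    intro g g' hg
    have : g'⁻¹ * g ∈ stabilizer G o := by
      rw [mem_stabilizer_iff, mul_smul, inv_smul_eq_iff, hg]
    have := h this
    rwa [mem_stabilizer_iff, mul_smul, inv_smul_eq_iff] at this
  refine ⟨⟨fun o' => γ o' • t, fun g o' => ?_⟩, ?_⟩
  · change γ (g • o') • t = g • γ o' • t
    rw [← mul_smul]
    apply key
    rw [hγ, mul_smul, hγ]
  · change γ o • t = t
    have := key (γ o) 1 (by rw [hγ, one_smul])
    rwa [one_smul] at this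

end Classes

/-! ### Cyclic words of prime length and their stabilizers. -/

section CyclicWords

/-- Words indexed by `ZMod p`, up to rotation. -/
def rotSetoid (p : ℕ) (Y : Type*) : Setoid (ZMod p → Y) where
  r y y' := ∃ c, ∀ i, y' i = y (i + c)
  iseqv :=
    { refl := fun y => ⟨0, fun i => by rw [add_zero]⟩
      symm := fun {y y'} ⟨c, hc⟩ => ⟨-c, fun i => by rw [hc, neg_add_cancel_right]⟩
      trans := fun {y y' y''} ⟨c, hc⟩ ⟨d, hd⟩ => ⟨d + c, fun i => by rw [hd, hc, add_assoc]⟩ }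

/-- Cyclic words of length `p`. -/
def Cyc (p : ℕ) (Y : Type*) := Quotient (rotSetoid p Y)

namespace Cyc

variable {p : ℕ} {Y Z : Type*}

/-- The cyclic word of a word. -/
def mk (y : ZMod p → Y) : Cyc p Y := Quotient.mk (rotSetoid p Y) y

theorem mk_eq_mk {y y' : ZMod p → Y} : mk y = mk y' ↔ ∃ c, ∀ i, y' i = y (i + c) :=
  Quotient.eq (r := rotSetoid p Y)

theorem mk_surjective : Function.Surjective (mk : (ZMod p → Y) → Cyc p Y) :=
  Quotient.mk_surjective

/-- A word representing a cyclic word. -/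
noncomputable def out (q : Cyc p Y) : ZMod p → Y := Quotient.out q

theorem mk_out (q : Cyc p Y) : mk q.out = q := Quotient.out_eq q

/-- Applying a map letter by letter. -/
def map (f : Y → Z) : Cyc p Y → Cyc p Z :=
  Quotient.map (fun y i => f (y i)) fun _ _ ⟨c, hc⟩ => ⟨c, fun i => congrArg f (hc i)⟩

theorem map_mk (f : Y → Z) (y : ZMod p → Y) : map f (mk y) = mk fun i => f (y i) := rfl

/-- The cyclic words all of whose letters are equal. -/
def IsConst (q : Cyc p Y) : Prop := ∃ a, q = mk fun _ => a

theorem isConst_mk {y : ZMod p → Y} : (mk y).IsConst ↔ ∀ i, y i = y 0 := by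
  constructor
  · rintro ⟨a, ha⟩ i
    obtain ⟨c, hc⟩ := mk_eq_mk.1 ha.symm
    rw [hc, hc]
  · intro h
    exact ⟨y 0, congrArg mk (funext h)⟩

/-- The letter of a constant cyclic word. -/
noncomputable def val (q : Cyc p Y) : Y := q.out 0

theorem val_mk {y : ZMod p → Y} (h : (mk y).IsConst) (i : ZMod p) : (mk y).val = y i := by
  obtain ⟨c, hc⟩ := mk_eq_mk.1 (mk_out (mk y)).symm
  rw [isConst_mk] at h
  rw [val, hc, h, ← h i]

theorem mk_const_injective : Function.Injective fun a : Y => (mk fun _ : ZMod p => a) := by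
  intro a b h
  obtain ⟨c, hc⟩ := mk_eq_mk.1 h
  exact (hc 0).symm

/-- A word that is invariant under a nontrivial rotation is constant. -/
theorem eq_of_rotation_invariant [Fact p.Prime] {y : ZMod p → Y} {c : ZMod p} (hc : c ≠ 0)
    (h : ∀ i, y (i + c) = y i) (i : ZMod p) : y i = y 0 := by
  have key : ∀ n : ℕ, y (n * c) = y 0 := by
    intro n
    induction n with
    | zero => simp
    | succ n ih => rw [← ih, ← h (n * c)]; push_cast; ring_nf
  have := key (i * c⁻¹).val
  rwa [ZMod.natCast_zmod_val, inv_mul_cancel_right₀ hc] at this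

/-- Primality of `p` enters here: the `p` rotations of a nonconstant word are distinct. -/
theorem rotation_injective [Fact p.Prime] {y : ZMod p → Y} (hy : ¬ (mk y).IsConst) {c d : ZMod p}
    (h : ∀ i, y (i + c) = y (i + d)) : c = d := by
  by_contra hne
  refine hy (isConst_mk.2 (eq_of_rotation_invariant (sub_ne_zero.2 hne) fun i => ?_))
  have := h (i - d)
  rwa [sub_add_cancel, ← add_sub_right_comm, add_sub_assoc] at this

variable {G : Type*} [Group G] [MulAction G Y] [MulAction G Z]

instance : MulAction G (Cyc p Y) where
  smul g := map (g • ·)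
  one_smul q := by
    obtain ⟨y, rfl⟩ := mk_surjective q
    exact congrArg mk (funext fun i => one_smul G (y i))
  mul_smul g h q := by
    obtain ⟨y, rfl⟩ := mk_surjective q
    exact congrArg mk (funext fun i => mul_smul g h (y i))

theorem smul_mk (g : G) (y : ZMod p → Y) : g • mk y = mk (g • y) := rfl

/-- `Cyc.mk` as an equivariant map. -/
def mkHom : (ZMod p → Y) →[G] Cyc p Y := ⟨mk, fun _ _ => rfl⟩

theorem map_smul (f : Y →[G] Z) (g : G) (q : Cyc p Y) : map f (g • q) = g • map f q := by
  obtain ⟨y, rfl⟩ := mk_surjective q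
  exact congrArg mk (funext fun i => _root_.map_smul f g (y i))

theorem IsConst.smul {q : Cyc p Y} (h : q.IsConst) (g : G) : (g • q).IsConst := by
  obtain ⟨a, rfl⟩ := h
  exact ⟨g • a, rfl⟩

theorem isConst_smul {q : Cyc p Y} (g : G) : (g • q).IsConst ↔ q.IsConst :=
  ⟨fun h => by simpa using h.smul g⁻¹, fun h => h.smul g⟩

theorem IsConst.val_smul {q : Cyc p Y} (h : q.IsConst) (g : G) : (g • q).val = g • q.val := by
  obtain ⟨a, rfl⟩ := h
  have h1 : (mk fun _ : ZMod p => a).val = a := val_mk ⟨a, rfl⟩ 0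
  rw [h1]
  exact val_mk (y := fun _ : ZMod p => g • a) ⟨g • a, rfl⟩ 0

end Cyc

variable {G Ω : Type u} [Group G] [MulAction G Ω] {p : ℕ} [hp : Fact p.Prime]

/-- If `g` rotates the word, then `g ^ p` fixes every letter; as there are no nontrivial finite
cycles, `g` fixes every letter. -/
theorem Cyc.smul_eq_of_smul_mk [Tame G Ω] {Y : Type u} [MulAction G Y] (hY : Smooth G Ω Y) {g : G}
    {y : ZMod p → Y} (h : g • Cyc.mk y = Cyc.mk y) : g • y = y := by
  obtain ⟨c, hc⟩ := Cyc.mk_eq_mk.1 ((Cyc.smul_mk g y).symm.trans h)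
  funext i
  have key : ∀ n : ℕ, g ^ n • y (i + n * c) = y i := by
    intro n
    induction n with
    | zero => simp
    | succ n ih =>
      rw [← ih, hc (i + n * c), pow_succ, mul_smul, Pi.smul_apply]
      push_cast
      ring_nf
  refine smul_eq_of_pow_smul_eq hY hp.out.pos ?_
  have := key p
  rwa [CharP.cast_eq_zero, zero_mul, add_zero] at this

theorem Cyc.stabilizer_mk [Tame G Ω] {Y : Type u} [MulAction G Y] (hY : Smooth G Ω Y)
    (y : ZMod p → Y) : stabilizer G (Cyc.mk y) = stabilizer G y :=
  le_antisymm (fun _ hg => Cyc.smul_eq_of_smul_mk hY hg) (stabilizer_le_map (Cyc.mkHom : _ →[G] Cyc p Y) y)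

instance [Tame G Ω] {Y : Type u} [MulAction G Y] [hY : Smooth G Ω Y] : Smooth G Ω (Cyc p Y) where
  finitary := by
    have := Smooth.finitary (G := G) (Ω := Ω) (T := ZMod p → Y)
    exact finite_orbits_of_surjective Cyc.mkHom Cyc.mk_surjective
  stabilizer_mem q := by
    obtain ⟨y, rfl⟩ := Cyc.mk_surjective q
    rw [Cyc.stabilizer_mk hY]
    exact Smooth.stabilizer_mem _

variable {X X' Y Y' Z Z' O T : Type u} [MulAction G X] [MulAction G X'] [MulAction G Y]
  [MulAction G Y'] [MulAction G Z] [MulAction G Z'] [MulAction G O] [MulAction G T]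

/-- Equivariant families of cyclic words over a transitive set lift to words. -/
theorem exists_section [Tame G Ω] (hY : Smooth G Ω Y) [hO : Trans G O] (k : O →[G] Cyc p Y) :
    ∃ s : O →[G] (ZMod p → Y), ∀ o, Cyc.mk (s o) = k o := by
  obtain ⟨o⟩ := hO.nonempty
  obtain ⟨y, hy⟩ := Cyc.mk_surjective (k o)
  -- The chosen word `y` costs no symmetry: its stabilizer is that of its cyclic word.
  obtain ⟨s, hs⟩ := exists_hom_of_stabilizer_le o y (by
    rw [← Cyc.stabilizer_mk hY, hy]
    exact stabilizer_le_map k o)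
  refine ⟨s, fun o' => ?_⟩
  obtain ⟨g, rfl⟩ := hO.exists_smul_eq o o'
  rw [map_smul, map_smul, hs, ← hy, Cyc.smul_mk]

variable (p) in
/-- The cyclic words of length `p` in the fibers of `f`. -/
def cycFib (f : Y →[G] X) : SubMulAction G (Cyc p Y) :=
  invSub (fun q => (q.map f).IsConst) fun g q h => by rw [Cyc.map_smul]; exact h.smul g

variable (p) in
/-- The map to `X` from the set of cyclic words in the fibers of `f : Y → X`. -/
noncomputable def cycFibHom (f : Y →[G] X) : cycFib p f →[G] X where
  toFun q := (q.1.map f).val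
  map_smul' g q := by
    change (Cyc.map f (g • q.1)).val = _
    rw [Cyc.map_smul]
    exact Cyc.IsConst.val_smul q.2 g

theorem mk_mem_cycFib {f : Y →[G] X} {y : ZMod p → Y} :
    Cyc.mk y ∈ cycFib p f ↔ ∀ i, f (y i) = f (y 0) := Cyc.isConst_mk

theorem cycFibHom_mk {f : Y →[G] X} {y : ZMod p → Y} (h : Cyc.mk y ∈ cycFib p f) (i : ZMod p) :
    cycFibHom p f ⟨Cyc.mk y, h⟩ = f (y i) :=
  Cyc.val_mk (y := fun i => f (y i)) h i

/-- All letters of a cyclic word in a fiber lie over one point of the base, so over a given `x'`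
each letter lifts uniquely. -/
theorem cart_cycFib {f' : Y' →[G] X'} {f : Y →[G] X} {h : Y' →[G] Y} {k : X' →[G] X}
    (H : Cart f' f h k) : ∃ h', Cart (cycFibHom p f') (cycFibHom p f) h' k := by
  have hmem : ∀ q ∈ cycFib p f', q.map h ∈ cycFib p f := by
    intro q hq
    obtain ⟨y, rfl⟩ := Cyc.mk_surjective q
    rw [mk_mem_cycFib] at hq
    rw [Cyc.map_mk, mk_mem_cycFib]
    intro i
    rw [H.1, H.1, hq]
  refine ⟨⟨fun q => ⟨q.1.map h, hmem _ q.2⟩, fun g q => Subtype.ext (Cyc.map_smul h g q.1)⟩,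
    ?_, ?_⟩
  · rintro ⟨q, hq⟩
    obtain ⟨y, rfl⟩ := Cyc.mk_surjective q
    rw [cycFibHom_mk hq 0, ← H.1]
    exact cycFibHom_mk (hmem _ hq) 0
  · rintro ⟨q, hq⟩ x' hx
    obtain ⟨y, rfl⟩ := Cyc.mk_surjective q
    have hy : ∀ i, f (y i) = k x' := fun i => (cycFibHom_mk hq i).symm.trans hx
    choose y' hy' huniq using fun i => H.2 (y i) x' (hy i)
    have hy'm : Cyc.mk y' ∈ cycFib p f' := by
      rw [mk_mem_cycFib]
      intro i
      rw [(hy' i).2, (hy' 0).2]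
    refine ⟨⟨Cyc.mk y', hy'm⟩, ⟨Subtype.ext (congrArg Cyc.mk (funext fun i => (hy' i).1)), ?_⟩, ?_⟩
    · exact (cycFibHom_mk hy'm 0).trans (hy' 0).2
    · rintro ⟨q', hq'⟩ ⟨h1, h2⟩
      obtain ⟨w, rfl⟩ := Cyc.mk_surjective q'
      have h3 : Cyc.mk (fun i => h (w i)) = Cyc.mk y := congrArg Subtype.val h1
      obtain ⟨c, hc⟩ := Cyc.mk_eq_mk.1 h3
      refine Subtype.ext (Cyc.mk_eq_mk.2 ⟨c, fun i => ?_⟩)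
      exact (huniq i (w (i + c)) ⟨(hc i).symm, (cycFibHom_mk hq' (i + c)).symm.trans h2⟩).symm

variable [Smooth G Ω X] [Smooth G Ω X'] [hsY : Smooth G Ω Y] [Smooth G Ω Y'] [hsZ : Smooth G Ω Z]
  [Smooth G Ω Z'] [Smooth G Ω O] [Smooth G Ω T]

theorem cls_add_not [Trans G X] (f : Y →[G] X) (P : Y → Prop) (hP : ∀ (g : G) y, P (g • y) ↔ P y) :
    cls Ω f = cls Ω (f.comp (invSub P fun g y h => (hP g y).2 h).inclusion) +
      cls Ω (f.comp (invSub (fun y => ¬ P y) fun g y h h' => h ((hP g y).1 h')).inclusion) := by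
  refine cls_add Ω f _ _ ⟨?_, fun y => ?_⟩
  · rintro (⟨t, ht⟩ | ⟨t, ht⟩) (⟨t', ht'⟩ | ⟨t', ht'⟩) h <;>
      have h : t = t' := h <;> subst h
    · rfl
    · exact absurd ht ht'
    · exact absurd ht' ht
    · rfl
  · by_cases h : P y
    · exact ⟨Sum.inl ⟨y, h⟩, rfl⟩
    · exact ⟨Sum.inr ⟨y, h⟩, rfl⟩

/-- Two base changes along the same map are isomorphic, so one model over each transitive base is
enough. -/
theorem HasCls.of_exists {f : Y →[G] X} {v : Theta G (stabClass G Ω)}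
    (H : ∀ (O : Type u) [MulAction G O] [Smooth G Ω O] [Trans G O] (k : O →[G] X),
      ∃ (Z : Type u) (_ : MulAction G Z) (_ : Smooth G Ω Z) (f' : Z →[G] O) (h : Z →[G] Y),
        Cart f' f h k ∧ cls Ω f' = v) : HasCls Ω f v := by
  intro O Z _ _ _ _ _ f' h k hc
  obtain ⟨Z', _, _, f'', h', hc', rfl⟩ := H O k
  choose e he huniq using fun z : Z => hc'.2 (h z) (f' z) (hc.1 z)
  have he1 : ∀ z, h' (e z) = h z := fun z => (he z).1
  have he2 : ∀ z, f'' (e z) = f' z := fun z => (he z).2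
  let E : Z →[G] Z' := ⟨e, fun g z => ((huniq (g • z) (g • e z)) ⟨by
    rw [map_smul, map_smul, he1], by rw [map_smul, map_smul, he2]⟩).symm⟩
  have hE : Function.Bijective E := by
    constructor
    · intro a b hab
      have hab : e a = e b := hab
      obtain ⟨z, -, hz⟩ := hc.2 (h a) (f' a) (hc.1 a)
      rw [hz a ⟨rfl, rfl⟩, hz b ⟨by rw [← he1, ← hab, he1], by rw [← he2, ← hab, he2]⟩]
    · intro z'
      obtain ⟨z, ⟨hz1, hz2⟩, -⟩ := hc.2 (h' z') (f'' z') (hc'.1 z')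
      refine ⟨z, ?_⟩
      exact (huniq z z' ⟨hz1.symm, hz2.symm⟩).symm
  have : f' = f''.comp E := by
    ext z; exact (he2 z).symm
  rw [this]
  exact cls_comp_bijective Ω f'' hE

variable [Tame G Ω]

variable (Ω p) in
/-- The class of the set of cyclic words of length `p` in the fibers of `f`. -/
noncomputable def cycCls [Trans G X] (f : Y →[G] X) : Theta G (stabClass G Ω) :=
  cls Ω (cycFibHom p f)

theorem cycCls_eq_of_cart [Trans G X] [Trans G X'] {f' : Y' →[G] X'} {f : Y →[G] X} {h : Y' →[G] Y}
    {k : X' →[G] X} (H : Cart f' f h k) : cycCls Ω p f' = cycCls Ω p f := by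
  obtain ⟨h', H'⟩ := cart_cycFib (p := p) H
  exact cls_eq_of_cart Ω H'

theorem cycCls_eq_one [Trans G X] {f : Y →[G] X} (hf : Function.Bijective f) :
    cycCls Ω p f = 1 := by
  refine cls_eq_one Ω ⟨?_, fun x => ?_⟩
  · rintro ⟨q, hq⟩ ⟨q', hq'⟩ h
    obtain ⟨y, rfl⟩ := Cyc.mk_surjective q
    obtain ⟨y', rfl⟩ := Cyc.mk_surjective q'
    refine Subtype.ext (congrArg Cyc.mk (funext fun i => hf.1 ?_))
    rw [← cycFibHom_mk hq i, ← cycFibHom_mk hq' i, h]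
  · obtain ⟨y, rfl⟩ := hf.2 x
    exact ⟨⟨Cyc.mk fun _ => y, mk_mem_cycFib.2 fun _ => rfl⟩, cycFibHom_mk _ 0⟩

variable (p) in
/-- The nonconstant cyclic words in the fibers of `f`. -/
def ncFib (f : Y →[G] X) : SubMulAction G (cycFib p f) :=
  invSub (fun q => ¬ q.1.IsConst) fun g q h h' => h ((Cyc.isConst_smul g).1 h')

variable (p) in
/-- The map to `X` from the set of nonconstant cyclic words in the fibers of `f : Y → X`. -/
noncomputable def ncHom (f : Y →[G] X) : ncFib p f →[G] X :=
  (cycFibHom p f).comp (ncFib p f).inclusion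

/-- The constant cyclic words form a copy of `Y`. -/
theorem cycCls_eq_cls_add [Trans G X] (f : Y →[G] X) :
    cycCls Ω p f = cls Ω f + cls Ω (ncHom p f) := by
  rw [cycCls, cls_add_not (cycFibHom p f) (fun q => q.1.IsConst) fun g _ => Cyc.isConst_smul g]
  congr 1
  let e : Y →[G] (invSub (fun q : cycFib p f => q.1.IsConst)
      fun g q h => (Cyc.isConst_smul g).2 h) :=
    { toFun := fun y => ⟨⟨Cyc.mk fun _ => y, mk_mem_cycFib.2 fun _ => rfl⟩, ⟨y, rfl⟩⟩
      map_smul' := fun g y => by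
        refine Subtype.ext (Subtype.ext ?_)
        rw [id, SubMulAction.val_smul, SubMulAction.val_smul, Cyc.smul_mk]
        rfl }
  have he : Function.Bijective e := by
    constructor
    · intro a b h
      exact Cyc.mk_const_injective (congrArg (fun t => t.1.1) h)
    · rintro ⟨⟨q, hq⟩, a, ha⟩
      change q = _ at ha
      subst ha
      exact ⟨a, rfl⟩
  rw [← cls_comp_bijective Ω _ he]
  congr 1
  ext y
  exact cycFibHom_mk (y := fun _ => y) _ 0

end CyclicWords

/-! ### Fiber powers, and cyclic words of a composition. -/

section CyclicPower

variable {G Ω : Type u} [Group G] [MulAction G Ω] {p : ℕ} [hp : Fact p.Prime]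
variable {X X' Y Y' Z Z' O T : Type u} [MulAction G X] [MulAction G X'] [MulAction G Y]
  [MulAction G Y'] [MulAction G Z] [MulAction G Z'] [MulAction G O] [MulAction G T]
variable [Smooth G Ω X] [Smooth G Ω X'] [hsY : Smooth G Ω Y] [Smooth G Ω Y'] [hsZ : Smooth G Ω Z]
  [Smooth G Ω Z'] [Smooth G Ω O] [Smooth G Ω T] [Tame G Ω]

/-- The underlying cyclic word of a nonconstant cyclic word in a fiber. -/
def ncVal (f : Y →[G] X) : ncFib p f →[G] Cyc p Y :=
  (cycFib p f).inclusion.comp (ncFib p f).inclusion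

theorem ncHom_of_mk_eq {f : Y →[G] X} {t : ncFib p f} {y : ZMod p → Y} (h : Cyc.mk y = ncVal f t)
    (i : ZMod p) : ncHom p f t = f (y i) := by
  obtain ⟨⟨q, hq⟩, ht⟩ := t
  change Cyc.mk y = q at h
  subst h
  exact cycFibHom_mk hq i

/-- The pairs of points of `Y` and `X` related by `f`. -/
def graphSub (f : Y →[G] X) : SubMulAction G (Y × X) :=
  invSub (fun t => f t.1 = t.2) fun g t h => by
    rw [Prod.smul_fst, Prod.smul_snd, map_smul, h]

theorem cls_graphSub [Trans G X] (f : Y →[G] X) : cls Ω (sndHom (graphSub f)) = cls Ω f := by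
  have he : Function.Bijective (fstHom (graphSub f)) := by
    constructor
    · rintro ⟨⟨y, x⟩, h⟩ ⟨⟨y', x'⟩, h'⟩ hh
      change f y = x at h
      change f y' = x' at h'
      change y = y' at hh
      subst hh
      subst h
      subst h'
      rfl
    · exact fun y => ⟨⟨(y, f y), rfl⟩, rfl⟩
  rw [← cls_comp_bijective Ω f he]
  congr 1
  ext t
  exact t.2.symm

/-- The word of a family of points. -/
def wordHom {ι : Type} (W : ι → SubMulAction G (Z × X)) : piSub W →[G] (ι → Z) := fstHom _

/-- The fiber power of `f` is made up of `Y` and of `p` copies of the set of nonconstant cyclic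
words. -/
theorem cls_pow_prime [Trans G X] (f : Y →[G] X) :
    cls Ω f ^ p = cls Ω f + p * cls Ω (ncHom p f) := by
  let W : ZMod p → SubMulAction G (Y × X) := fun _ => graphSub f
  have h1 : cls Ω (sndHom (piSub W)) = cls Ω f ^ p := by
    rw [cls_piSub, Finset.prod_congr rfl fun i _ => cls_graphSub f, Finset.prod_const,
      Finset.card_univ, ZMod.card]
  have hsmul : ∀ (g : G) (t : piSub W), (Cyc.mk (wordHom W (g • t))).IsConst ↔
      (Cyc.mk (wordHom W t)).IsConst := fun g t => by
    rw [map_smul, ← Cyc.smul_mk, Cyc.isConst_smul]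
  rw [← h1, cls_add_not (sndHom (piSub W)) (fun t => (Cyc.mk (wordHom W t)).IsConst) hsmul]
  congr 1
  · let e : Y →[G] (invSub (fun t : piSub W => (Cyc.mk (wordHom W t)).IsConst)
        fun g t h => (hsmul g t).2 h) :=
      { toFun := fun y => ⟨⟨(fun _ => y, f y), fun _ => rfl⟩, ⟨y, rfl⟩⟩
        map_smul' := fun g y => Subtype.ext (piSub_ext rfl (map_smul f g y)) }
    have he : Function.Bijective e := by
      constructor
      · intro a b h
        exact congrFun (congrArg (fun t => (wordHom W t.1)) h) 0
      · rintro ⟨t, ht⟩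
        have hc := Cyc.isConst_mk.1 ht
        refine ⟨wordHom W t 0, Subtype.ext (piSub_ext (funext fun i => (hc i).symm) ?_)⟩
        exact t.2 0
    rw [← cls_comp_bijective Ω _ he]
    rfl
  · let V := invSub (fun t : piSub W => ¬ (Cyc.mk (wordHom W t)).IsConst)
      fun g t h h' => h ((hsmul g t).1 h')
    have hw : ∀ t : V, ∀ i, f (wordHom W t.1 i) = sndHom (piSub W) t.1 := fun t i => t.1.2 i
    let u : V →[G] ncFib p f :=
      { toFun := fun t => ⟨⟨Cyc.mk (wordHom W t.1), mk_mem_cycFib.2 fun i => by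
            rw [hw, hw]⟩, t.2⟩
        map_smul' := fun g t => Subtype.ext (Subtype.ext rfl) }
    have huval : ∀ t, ncVal f (u t) = Cyc.mk (wordHom W t.1) := fun _ => rfl
    -- Over a transitive base, a section `s` picks a word in each cyclic word. Every other word is
    -- its rotation by a unique `c`, which is invariant under `G`; the `p` values of `c` cut the
    -- cover into sheets isomorphic to the base.
    have hu : HasCls Ω u (p : Theta G (stabClass G Ω)) := by
      intro O' Z' _ _ _ _ _ f' h k hc
      obtain ⟨s, hs⟩ := exists_section hsY ((ncVal f).comp k)
      have hnc : ∀ o, ¬ (Cyc.mk (s o)).IsConst := fun o => by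
        rw [hs]; exact (k o).2
      have hrot : ∀ z : Z', ∃ c, ∀ i, wordHom W (h z).1 i = s (f' z) (i + c) := fun z => by
        rw [← Cyc.mk_eq_mk, hs, MulActionHom.comp_apply, ← hc.1 z, huval]
      choose c hcrot using hrot
      have huniq : ∀ z d, (∀ i, wordHom W (h z).1 i = s (f' z) (i + d)) → c z = d := fun z d hd =>
        Cyc.rotation_injective (hnc (f' z)) fun i => (hcrot z i).symm.trans (hd i)
      have hcs : ∀ (g : G) z, c (g • z) = c z := fun g z => by
        refine huniq _ _ fun i => ?_
        rw [map_smul, map_smul]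
        exact (congrFun (map_smul (wordHom W) g (h z).1) i).trans ((congrArg (g • ·)
          (hcrot z i)).trans (congrFun (map_smul s g (f' z)) (i + c z)).symm)
      rw [cls_eq_sum Ω f' c hcs, Finset.sum_congr rfl (g := fun _ => 1), Finset.sum_const,
        Finset.card_univ, ZMod.card, nsmul_eq_mul, mul_one]
      intro d _
      refine cls_eq_one Ω ⟨?_, fun o => ?_⟩
      · rintro ⟨z, hz⟩ ⟨z', hz'⟩ (hzz : f' z = f' z')
        change c z = d at hz
        change c z' = d at hz'
        obtain ⟨w, -, hw'⟩ := hc.2 (h z) (f' z) (hc.1 z)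
        have e1 : h z' = h z := by
          refine Subtype.ext (piSub_ext (funext fun i => ?_) ?_)
          · refine (hcrot z' i).trans (Eq.trans ?_ (hcrot z i).symm)
            rw [hz, hz', hzz]
          · refine ((hw (h z') 0).symm.trans (Eq.trans ?_ (hw (h z) 0)))
            rw [hcrot, hcrot, hz, hz', hzz]
        exact Subtype.ext ((hw' z ⟨rfl, rfl⟩).trans (hw' z' ⟨e1, hzz.symm⟩).symm)
      · have hfs : ∀ i, f (s o i) = ncHom p f (k o) := fun i => (ncHom_of_mk_eq (hs o) i).symm
        have hmk : Cyc.mk (fun i => s o (i + d)) = Cyc.mk (s o) :=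
          (Cyc.mk_eq_mk.2 ⟨d, fun i => rfl⟩).symm
        let t : V := ⟨⟨(fun i => s o (i + d), ncHom p f (k o)), fun i => hfs _⟩, by
          change ¬ (Cyc.mk fun i => s o (i + d)).IsConst
          rw [hmk]
          exact hnc o⟩
        obtain ⟨z, ⟨hz1, hz2⟩, -⟩ := hc.2 t o (Subtype.ext (Subtype.ext (hmk.trans (hs o))))
        refine ⟨⟨z, huniq z d fun i => ?_⟩, hz2⟩
        rw [hz1, hz2]
        rfl
    rw [mul_comm, ← hu.cls_comp (ncHom p f)]
    congr 1
    ext t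
    exact (hw t 0).symm.trans (ncHom_of_mk_eq (t := u t) (huval t).symm 0).symm

set_option maxHeartbeats 1000000 in
/-- The cyclic words of a composition. -/
theorem cycCls_comp [Trans G Y] [Trans G X] (f : Y →[G] X) (g : Z →[G] Y) :
    cycCls Ω p (f.comp g) =
      cls Ω f * cycCls Ω p g + cls Ω (ncHom p f) * cls Ω g ^ p := by
  have hsmul : ∀ (γ : G) (q : cycFib p (f.comp g)), ((γ • q).1.map g).IsConst ↔
      (q.1.map g).IsConst := fun γ q => by
    rw [SubMulAction.val_smul, Cyc.map_smul, Cyc.isConst_smul]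
  rw [cycCls, cls_add_not (cycFibHom p (f.comp g)) (fun q => (q.1.map g).IsConst) hsmul]
  congr 1
  · have hm : ∀ q ∈ cycFib p g, q ∈ cycFib p (f.comp g) := fun q hq => by
      obtain ⟨z, rfl⟩ := Cyc.mk_surjective q
      rw [mk_mem_cycFib] at hq ⊢
      exact fun i => congrArg f (hq i)
    let e : cycFib p g →[G] (invSub (fun q : cycFib p (f.comp g) => (q.1.map g).IsConst)
        fun γ q h => (hsmul γ q).2 h) :=
      { toFun := fun q => ⟨⟨q.1, hm _ q.2⟩, q.2⟩
        map_smul' := fun _ _ => rfl }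
    have he : Function.Bijective e := by
      constructor
      · intro a b h
        exact Subtype.ext (congrArg (fun t => t.1.1) h)
      · rintro ⟨⟨q, hq⟩, hq'⟩
        exact ⟨⟨q, hq'⟩, rfl⟩
    rw [cycCls, ← cls_comp Ω f, ← cls_comp_bijective Ω _ he]
    congr 1
    ext ⟨q, hq⟩
    obtain ⟨z, rfl⟩ := Cyc.mk_surjective q
    exact (cycFibHom_mk (hm _ hq) 0).trans (congrArg f (cycFibHom_mk hq 0)).symm
  · let V := invSub (fun q : cycFib p (f.comp g) => ¬ (q.1.map g).IsConst)
      fun γ q h h' => h ((hsmul γ q).1 h')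
    have hVm : ∀ q : V, q.1.1.map g ∈ cycFib p f := fun q => by
      obtain ⟨⟨q, hq⟩, hq'⟩ := q
      obtain ⟨z, rfl⟩ := Cyc.mk_surjective q
      exact mk_mem_cycFib.2 (mk_mem_cycFib.1 hq)
    let u : V →[G] ncFib p f :=
      { toFun := fun q => ⟨⟨q.1.1.map g, hVm q⟩, q.2⟩
        map_smul' := fun γ q => Subtype.ext (Subtype.ext (Cyc.map_smul g γ q.1.1)) }
    -- Once a section `s` breaks the rotational symmetry of the nonconstant word in `Y`, a cyclic
    -- word in `Z` above it is a free choice of one point in each of the `p` fibers of `g`.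
    have hu : HasCls Ω u (cls Ω g ^ p) := by
      refine HasCls.of_exists fun O' _ _ _ k => ?_
      obtain ⟨s, hs⟩ := exists_section hsY ((ncVal f).comp k)
      have hnc : ∀ o, ¬ (Cyc.mk (s o)).IsConst := fun o => by
        rw [hs]; exact (k o).2
      have hfs : ∀ o i, f (s o i) = ncHom p f (k o) := fun o i => (ncHom_of_mk_eq (hs o) i).symm
      let W : ZMod p → SubMulAction G (Z × O') := fun i =>
        pullback g ⟨fun o => s o i, fun γ o => congrFun (map_smul s γ o) i⟩
      have hW : ∀ t : piSub W, ∀ i, g (wordHom W t i) = s (sndHom _ t) i := fun t i => t.2 i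
      have hWg : ∀ t : piSub W, Cyc.map g (Cyc.mk (wordHom W t)) = Cyc.mk (s (sndHom _ t)) :=
        fun t => congrArg Cyc.mk (funext fun i => hW t i)
      let h : piSub W →[G] V :=
        { toFun := fun t => ⟨⟨Cyc.mk (wordHom W t), mk_mem_cycFib.2 fun i => by
              rw [MulActionHom.comp_apply, MulActionHom.comp_apply, hW, hW, hfs, hfs]⟩, by
              change ¬ (Cyc.map g (Cyc.mk (wordHom W t))).IsConst
              rw [hWg]
              exact hnc _⟩
          map_smul' := fun γ t => Subtype.ext (Subtype.ext rfl) }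
      refine ⟨piSub W, inferInstance, inferInstance, sndHom _, h, ⟨fun t => ?_, ?_⟩, ?_⟩
      · exact Subtype.ext (Subtype.ext ((hWg t).trans (hs _)))
      · rintro ⟨⟨q, hq⟩, hq'⟩ o ho
        obtain ⟨z, rfl⟩ := Cyc.mk_surjective q
        have ho' : Cyc.mk (fun i => g (z i)) = Cyc.mk (s o) :=
          (congrArg (ncVal f) ho).trans (hs o).symm
        obtain ⟨c, hc⟩ := Cyc.mk_eq_mk.1 ho'
        refine ⟨⟨(fun i => z (i + c), o), fun i => (hc i).symm⟩, ⟨?_, rfl⟩, ?_⟩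
        · exact Subtype.ext (Subtype.ext (Cyc.mk_eq_mk.2 ⟨c, fun i => rfl⟩).symm)
        · rintro t ⟨h1, h2⟩
          have h1' : Cyc.mk (wordHom W t) = Cyc.mk z := congrArg (fun q : V => q.1.1) h1
          obtain ⟨d, hd⟩ := Cyc.mk_eq_mk.1 h1'.symm
          refine piSub_ext (funext fun i => ?_) h2
          -- Both rotations match the same nonconstant word in `Y`.
          have hdc : c = d := by
            refine Cyc.rotation_injective (y := fun i => g (z i)) hq' fun i => ?_
            rw [← hc, ← hd, hW, h2]
          exact (hd i).trans (congrArg (fun c => z (i + c)) hdc.symm)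
      · have hWc : ∀ i, cls Ω (sndHom (W i)) = cls Ω g := fun i =>
          cls_eq_of_cart Ω (cart_pullback g ⟨fun o => s o i, fun γ o => congrFun (map_smul s γ o) i⟩)
        rw [cls_piSub, Finset.prod_congr rfl fun i _ => hWc i, Finset.prod_const,
          Finset.card_univ, ZMod.card]
    rw [← hu.cls_comp (ncHom p f)]
    congr 1
    ext ⟨⟨q, hq⟩, hq'⟩
    obtain ⟨z, rfl⟩ := Cyc.mk_surjective q
    exact (cycFibHom_mk hq 0).trans
      (ncHom_of_mk_eq (t := u ⟨⟨Cyc.mk z, hq⟩, hq'⟩) (y := fun i => g (z i)) rfl 0).symm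

/-- The nonconstant cyclic words of a map of transitive sets factor through the map. -/
theorem exists_cls_ncHom_eq_mul [Trans G X] [Trans G Y] (f : Y →[G] X)
    (S : AddSubgroup (Theta G (stabClass G Ω)))
    (hS : ∀ (O : Type u) [MulAction G O] [Smooth G Ω O] [Trans G O] (s : O →[G] (ZMod p → Y))
      (s₀ : O →[G] Y), (∀ o, s₀ o = s o 0) → (∀ o i, f (s o i) = f (s₀ o)) →
      (∀ o, stabilizer G o = stabilizer G (s o)) → cls Ω s₀ ∈ S) :
    ∃ c ∈ S, cls Ω (ncHom p f) = cls Ω f * c := by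
  have := Smooth.finitary (G := G) (Ω := Ω) (T := ncFib p f)
  have := Fintype.ofFinite (orbitRel.Quotient G (ncFib p f))
  have key : ∀ q : orbitRel.Quotient G (ncFib p f), ∃ c ∈ S,
      cls Ω ((ncHom p f).comp (fiberSub orbMk orbMk_smul q).inclusion) = cls Ω f * c := by
    intro q
    let k := (ncVal f).comp (fiberSub (orbMk (G := G) (T := ncFib p f)) orbMk_smul q).inclusion
    have hk : Function.Injective k := fun a b h => Subtype.ext (Subtype.ext (Subtype.ext h))
    obtain ⟨s, hs⟩ := exists_section hsY k
    have hf : ∀ o i, ncHom p f o.1 = f (s o i) := fun o i => ncHom_of_mk_eq (hs o) i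
    -- The first letter of the lifted word; the map to `X` is `f` after it, which splits off the
    -- factor `cls Ω f`.
    let s₀ : fiberSub (orbMk (G := G) (T := ncFib p f)) orbMk_smul q →[G] Y :=
      ⟨fun o => s o 0, fun γ o => congrFun (map_smul s γ o) 0⟩
    refine ⟨cls Ω s₀, hS _ s s₀ (fun _ => rfl) (fun o i => (hf o i).symm.trans (hf o 0))
      fun o => ?_, ?_⟩
    · rw [← Cyc.stabilizer_mk hsY, hs, stabilizer_map_of_injective k hk]
    · rw [← cls_comp Ω f s₀]
      congr 1
      ext o
      exact hf o 0
  choose c hc hc' using key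
  refine ⟨∑ q, c q, sum_mem fun q _ => hc q, ?_⟩
  rw [cls_eq_sum Ω (ncHom p f) orbMk orbMk_smul, Finset.mul_sum]
  exact Finset.sum_congr rfl fun q _ => hc' q

end CyclicPower

/-! ### Cyclic words in a disjoint union, and the multinomial formula they mirror. -/

section CyclicSum

instance {p : ℕ} [Fact p.Prime] {ι : Type} [Finite ι] : Finite (Cyc p ι) :=
  Finite.of_surjective Cyc.mk Cyc.mk_surjective

open Classical in
/-- The sum over the nonconstant cyclic words in the alphabet `ι` of the products of the values of
their letters. -/
noncomputable def ncSum (p : ℕ) [Fact p.Prime] {ι : Type} [Fintype ι] {A : Type*} [CommRing A]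
    (a : ι → A) : A :=
  letI := Fintype.ofFinite (Cyc p ι)
  ∑ ω ∈ Finset.univ.filter fun ω : Cyc p ι => ¬ ω.IsConst, ∏ i, a (ω.out i)

theorem map_ncSum (p : ℕ) [Fact p.Prime] {ι : Type} [Fintype ι] {A B : Type*} [CommRing A]
    [CommRing B] (φ : A →+* B) (a : ι → A) : φ (ncSum p a) = ncSum p fun i => φ (a i) := by
  simp only [ncSum, map_sum, map_prod]

/-- A sum over cyclic words splits into the constant and the nonconstant ones. -/
theorem sum_cyc (p : ℕ) [Fact p.Prime] {ι : Type} [Fintype ι] [Fintype (Cyc p ι)]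
    {A : Type*} [AddCommGroup A] (F : Cyc p ι → A)
    [DecidablePred fun ω : Cyc p ι => ¬ ω.IsConst] :
    ∑ ω, F ω = ∑ b, F (Cyc.mk fun _ => b) +
      ∑ ω ∈ Finset.univ.filter (fun ω : Cyc p ι => ¬ ω.IsConst), F ω := by
  classical
  rw [← Finset.sum_filter_add_sum_filter_not Finset.univ (fun ω : Cyc p ι => ω.IsConst)]
  congr 1
  · refine (Finset.sum_bij (fun b _ => Cyc.mk fun _ => b) ?_ ?_ ?_ ?_).symm
    · exact fun b _ => Finset.mem_filter.2 ⟨Finset.mem_univ _, b, rfl⟩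
    · exact fun a _ b _ h => Cyc.mk_const_injective h
    · intro ω hω
      obtain ⟨b, rfl⟩ := (Finset.mem_filter.1 hω).2
      exact ⟨b, Finset.mem_univ _, rfl⟩
    · exact fun _ _ => rfl

/-- The multinomial formula for a prime exponent, with the terms grouped by cyclic words. -/
theorem sum_pow_prime (p : ℕ) [hp : Fact p.Prime] {ι : Type} [Fintype ι] {A : Type*} [CommRing A]
    (a : ι → A) : (∑ b, a b) ^ p = ∑ b, a b ^ p + p * ncSum p a := by
  classical
  let _ := Fintype.ofFinite (Cyc p ι)
  have h1 : (∑ b, a b) ^ p = ∑ w : ZMod p → ι, ∏ i, a (w i) := by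
    have := Finset.prod_univ_sum (ι := ZMod p) (κ := fun _ => ι) (fun _ => Finset.univ)
      (fun _ b => a b)
    rw [Finset.prod_const, Finset.card_univ, ZMod.card, Fintype.piFinset_univ] at this
    exact this
  rw [h1, ← Finset.sum_fiberwise Finset.univ (fun w => (Cyc.mk w : Cyc p ι)), sum_cyc]
  congr 1
  · refine Finset.sum_congr rfl fun b _ => ?_
    have : (Finset.univ.filter fun w : ZMod p → ι => Cyc.mk w = Cyc.mk fun _ => b) =
        {fun _ => b} := by
      ext w
      simp only [Finset.mem_filter, Finset.mem_univ, true_and, Finset.mem_singleton]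
      refine ⟨fun h => ?_, fun h => by rw [h]⟩
      obtain ⟨c, hc⟩ := Cyc.mk_eq_mk.1 h.symm
      exact funext hc
    rw [this, Finset.sum_singleton, Finset.prod_const, Finset.card_univ, ZMod.card]
  · rw [ncSum, Finset.mul_sum]
    refine Finset.sum_congr (by ext; simp) fun ω hω => ?_
    have hω' : ¬ (Cyc.mk ω.out).IsConst := by
      rw [Cyc.mk_out]; exact (Finset.mem_filter.1 hω).2
    have : ∑ w ∈ Finset.univ.filter (fun w : ZMod p → ι => Cyc.mk w = ω), ∏ i, a (w i) =
        ∑ c : ZMod p, ∏ i, a (ω.out i) := by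
      refine (Finset.sum_bij (fun c _ i => ω.out (i + c)) ?_ ?_ ?_ ?_).symm
      · intro c _
        refine Finset.mem_filter.2 ⟨Finset.mem_univ _, ?_⟩
        conv_rhs => rw [← Cyc.mk_out ω]
        exact (Cyc.mk_eq_mk.2 ⟨c, fun _ => rfl⟩).symm
      · exact fun c _ d _ h => Cyc.rotation_injective hω' (congrFun h)
      · intro w hw
        have hw := (Finset.mem_filter.1 hw).2
        rw [← Cyc.mk_out ω] at hw
        obtain ⟨c, hc⟩ := Cyc.mk_eq_mk.1 hw.symm
        exact ⟨c, Finset.mem_univ _, (funext hc).symm⟩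
      · exact fun c _ => (Equiv.prod_comp (Equiv.addRight c) fun i => a (ω.out i)).symm
    rw [this, Finset.sum_const, Finset.card_univ, ZMod.card, nsmul_eq_mul]

variable {G Ω : Type u} [Group G] [MulAction G Ω] {p : ℕ} [hp : Fact p.Prime]
variable {X Y T T' : Type u} [MulAction G X] [MulAction G Y] [MulAction G T] [MulAction G T']
variable [Smooth G Ω X] [hsY : Smooth G Ω Y] [Smooth G Ω T] [Smooth G Ω T'] [Tame G Ω]

/-- The cyclic words with letters in a disjoint union. -/
theorem cycCls_eq_sum [Trans G X] (f : Y →[G] X) {ι : Type} [Fintype ι] (β : Y → ι)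
    (hβ : ∀ (g : G) y, β (g • y) = β y) :
    cycCls Ω p f = ∑ b, cycCls Ω p (f.comp (fiberSub β hβ b).inclusion) +
      ncSum p fun b => cls Ω (f.comp (fiberSub β hβ b).inclusion) := by
  classical
  let _ := Fintype.ofFinite (Cyc p ι)
  let c : cycFib p f → Cyc p ι := fun q => q.1.map β
  have hc : ∀ (g : G) q, c (g • q) = c q := fun g q => by
    obtain ⟨q, hq⟩ := q
    obtain ⟨y, rfl⟩ := Cyc.mk_surjective q
    change Cyc.map β (Cyc.mk _) = Cyc.map β (Cyc.mk _)
    exact congrArg Cyc.mk (funext fun i => hβ g _)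
  rw [cycCls, cls_eq_sum Ω (cycFibHom p f) c hc, sum_cyc]
  congr 1
  · refine Finset.sum_congr rfl fun b _ => ?_
    have hm : ∀ q ∈ cycFib p (f.comp (fiberSub β hβ b).inclusion),
        q.map Subtype.val ∈ cycFib p f := fun q hq => by
      obtain ⟨y, rfl⟩ := Cyc.mk_surjective q
      exact mk_mem_cycFib.2 (mk_mem_cycFib.1 hq)
    have hcm : ∀ q : cycFib p (f.comp (fiberSub β hβ b).inclusion),
        c ⟨_, hm _ q.2⟩ = Cyc.mk fun _ => b := fun q => by
      obtain ⟨q, hq⟩ := q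
      obtain ⟨y, rfl⟩ := Cyc.mk_surjective q
      exact congrArg Cyc.mk (funext fun i => (y i).2)
    let e : cycFib p (f.comp (fiberSub β hβ b).inclusion) →[G]
        fiberSub c hc (Cyc.mk fun _ => b) :=
      { toFun := fun q => ⟨⟨_, hm _ q.2⟩, hcm q⟩
        map_smul' := fun g q =>
          Subtype.ext (Subtype.ext (Cyc.map_smul (fiberSub β hβ b).inclusion g q.1)) }
    have he : Function.Bijective e := by
      constructor
      · rintro ⟨q, hq⟩ ⟨q', hq'⟩ h
        obtain ⟨y, rfl⟩ := Cyc.mk_surjective q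
        obtain ⟨y', rfl⟩ := Cyc.mk_surjective q'
        have h : Cyc.mk (fun i => (y i).1) = Cyc.mk (fun i => (y' i).1) :=
          congrArg (fun q => q.1.1) h
        obtain ⟨d, hd⟩ := Cyc.mk_eq_mk.1 h
        exact Subtype.ext (Cyc.mk_eq_mk.2 ⟨d, fun i => Subtype.ext (hd i)⟩)
      · rintro ⟨⟨q, hq⟩, hqb⟩
        obtain ⟨y, rfl⟩ := Cyc.mk_surjective q
        obtain ⟨d, hd⟩ := Cyc.mk_eq_mk.1 (Eq.symm hqb)
        exact ⟨⟨Cyc.mk fun i => ⟨y i, hd i⟩, mk_mem_cycFib.2 (mk_mem_cycFib.1 hq)⟩, rfl⟩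
    rw [cycCls, ← cls_comp_bijective Ω _ he]
    congr 1
    ext ⟨q, hq⟩
    obtain ⟨y, rfl⟩ := Cyc.mk_surjective q
    exact (cycFibHom_mk (hm _ hq) 0).trans (cycFibHom_mk hq 0).symm
  · rw [ncSum]
    refine Finset.sum_congr (by ext; simp) fun ω hω => ?_
    have hω' : ¬ (Cyc.mk ω.out).IsConst := by
      rw [Cyc.mk_out]; exact (Finset.mem_filter.1 hω).2
    -- The colors of a cyclic word form a cyclic word `ω` in `ι`. If `ω` is not constant, aligning
    -- the colors with `ω.out` singles out one representing word, so the part over `ω` is a product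
    -- of color classes.
    let W : ZMod p → SubMulAction G (Y × X) := fun i =>
      invSub (fun t => f t.1 = t.2 ∧ β t.1 = ω.out i) fun g t h =>
        ⟨by rw [Prod.smul_fst, Prod.smul_snd, map_smul, h.1],
          by rw [Prod.smul_fst, hβ, h.2]⟩
    have hW : ∀ i, cls Ω (sndHom (W i)) =
        cls Ω (f.comp (fiberSub β hβ (ω.out i)).inclusion) := by
      intro i
      let e : fiberSub β hβ (ω.out i) →[G] W i :=
        { toFun := fun y => ⟨(y.1, f y.1), rfl, y.2⟩
          map_smul' := fun g y => Subtype.ext (Prod.ext rfl (map_smul f g y.1)) }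
      have he : Function.Bijective e := by
        constructor
        · intro a b h
          exact Subtype.ext (congrArg (fun t => t.1.1) h)
        · rintro ⟨⟨y, x⟩, h1, h2⟩
          exact ⟨⟨y, h2⟩, Subtype.ext (Prod.ext rfl h1)⟩
      rw [← cls_comp_bijective Ω _ he]
      rfl
    rw [← Finset.prod_congr rfl fun i _ => hW i, ← cls_piSub]
    have hWf : ∀ (t : piSub W) i, f (wordHom W t i) = sndHom _ t := fun t i => (t.2 i).1
    have hWβ : ∀ (t : piSub W) i, β (wordHom W t i) = ω.out i := fun t i => (t.2 i).2
    have hm : ∀ t : piSub W, Cyc.mk (wordHom W t) ∈ cycFib p f := fun t =>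
      mk_mem_cycFib.2 fun i => by rw [hWf, hWf]
    have hcm : ∀ t : piSub W, c ⟨_, hm t⟩ = ω := fun t =>
      Eq.trans (congrArg Cyc.mk (funext fun i => hWβ t i)) (Cyc.mk_out ω)
    let e : piSub W →[G] fiberSub c hc ω :=
      { toFun := fun t => ⟨⟨_, hm t⟩, hcm t⟩
        map_smul' := fun g t => Subtype.ext (Subtype.ext rfl) }
    have he : Function.Bijective e := by
      constructor
      · intro t t' h
        have h : Cyc.mk (wordHom W t) = Cyc.mk (wordHom W t') := congrArg (fun q => q.1.1) h
        obtain ⟨d, hd⟩ := Cyc.mk_eq_mk.1 h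
        have hd0 : d = 0 := by
          refine Cyc.rotation_injective hω' fun i => ?_
          rw [← hWβ t, ← hd, hWβ, add_zero]
        subst hd0
        have hw : wordHom W t = wordHom W t' := funext fun i => by rw [hd, add_zero]
        refine piSub_ext hw ?_
        have := hWf t 0
        rw [hw, hWf] at this
        exact this.symm
      · rintro ⟨⟨q, hq⟩, hqb⟩
        obtain ⟨y, rfl⟩ := Cyc.mk_surjective q
        have hqb : Cyc.mk (fun i => β (y i)) = ω := hqb
        rw [← Cyc.mk_out ω] at hqb
        obtain ⟨d, hd⟩ := Cyc.mk_eq_mk.1 hqb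
        refine ⟨⟨(fun i => y (i + d), f (y 0)), fun i => ⟨mk_mem_cycFib.1 hq _, (hd i).symm⟩⟩, ?_⟩
        exact Subtype.ext (Subtype.ext (Cyc.mk_eq_mk.2 ⟨d, fun _ => rfl⟩).symm)
    rw [← cls_comp_bijective Ω _ he]
    congr 1
    ext t
    exact (cycFibHom_mk (hm t) 0).trans (hWf t 0)

/-- The case of two colors, recording the summand to which a point belongs. -/
theorem cycCls_add [Trans G X] (f : Y →[G] X) (i : T →[G] Y) (j : T' →[G] Y)
    (h : Function.Bijective (Sum.elim i j)) :
    cycCls Ω p f = cycCls Ω p (f.comp i) + cycCls Ω p (f.comp j) +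
      ncSum p fun b : Bool => cond b (cls Ω (f.comp i)) (cls Ω (f.comp j)) := by
  classical
  let β : Y → Bool := fun y => decide (∃ t, i t = y)
  have hi : ∀ t, β (i t) = true := fun t => decide_eq_true ⟨t, rfl⟩
  have hj : ∀ t, β (j t) = false := fun t => by
    refine decide_eq_false ?_
    rintro ⟨t', ht'⟩
    exact Sum.inl_ne_inr (h.1 (a₁ := Sum.inl t') (a₂ := Sum.inr t) ht')
  have hβ : ∀ (g : G) y, β (g • y) = β y := fun g y => by
    obtain ⟨t | t, rfl⟩ := h.2 y
    · change β (g • i t) = β (i t)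
      rw [← map_smul, hi, hi]
    · change β (g • j t) = β (j t)
      rw [← map_smul, hj, hj]
  let ei : T →[G] fiberSub β hβ true := ⟨fun t => ⟨i t, hi t⟩, fun g t => Subtype.ext (map_smul i g t)⟩
  let ej : T' →[G] fiberSub β hβ false :=
    ⟨fun t => ⟨j t, hj t⟩, fun g t => Subtype.ext (map_smul j g t)⟩
  have hei : Function.Bijective ei := by
    constructor
    · intro a b hab
      have hab : i a = i b := congrArg Subtype.val hab
      exact Sum.inl_injective (h.1 (a₁ := Sum.inl a) (a₂ := Sum.inl b) hab)
    · rintro ⟨y, hy⟩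
      obtain ⟨t | t, rfl⟩ := h.2 y
      · exact ⟨t, rfl⟩
      · exact absurd ((hj t).symm.trans hy) Bool.false_ne_true
  have hej : Function.Bijective ej := by
    constructor
    · intro a b hab
      have hab : j a = j b := congrArg Subtype.val hab
      exact Sum.inr_injective (h.1 (a₁ := Sum.inr a) (a₂ := Sum.inr b) hab)
    · rintro ⟨y, hy⟩
      obtain ⟨t | t, rfl⟩ := h.2 y
      · exact absurd ((hi t).symm.trans hy).symm Bool.false_ne_true
      · exact ⟨t, rfl⟩
  have h1 := cls_comp_bijective Ω (f.comp (fiberSub β hβ true).inclusion) hei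
  have h2 := cls_comp_bijective Ω (f.comp (fiberSub β hβ false).inclusion) hej
  have h3 : cycCls Ω p ((f.comp (fiberSub β hβ true).inclusion).comp ei) =
      cycCls Ω p (f.comp (fiberSub β hβ true).inclusion) :=
    cycCls_eq_of_cart (Cart.of_bijective hei (k := MulActionHom.id G) Function.bijective_id
      fun _ => rfl)
  have h4 : cycCls Ω p ((f.comp (fiberSub β hβ false).inclusion).comp ej) =
      cycCls Ω p (f.comp (fiberSub β hβ false).inclusion) :=
    cycCls_eq_of_cart (Cart.of_bijective hej (k := MulActionHom.id G) Function.bijective_id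
      fun _ => rfl)
  rw [cycCls_eq_sum f β hβ, Fintype.sum_bool, ← h3, ← h4]
  congr 1
  congr 1
  funext b
  cases b
  · exact h2.symm
  · exact h1.symm

end CyclicSum

/-! ### The Frobenius lift on the polynomial ring, and torsion-freeness of `Theta`. -/

section Delta

/-- Let `φ` be a lift of Frobenius, with `φ x = x ^ p + p δ(x)`. If `δ` maps generators of an ideal
into the ideal, then it maps the whole ideal into itself. -/
theorem exists_delta_mem_of_mem_span {P : Type*} [CommRing P] {p : ℕ} (hp : p.Prime) {φ : P →+* P}
    {R : Set P} (hfrob : ∀ x, ∃ d, φ x = x ^ p + p * d)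
    (hR : ∀ r ∈ R, ∃ d ∈ Ideal.span R, φ r = r ^ p + p * d) {x : P} (hx : x ∈ Ideal.span R) :
    ∃ d ∈ Ideal.span R, φ x = x ^ p + p * d := by
  induction hx using Submodule.span_induction with
  | mem x hx => exact hR x hx
  | zero => exact ⟨0, zero_mem _, by simp [hp.ne_zero]⟩
  | add x y hx hy h1 h2 =>
    obtain ⟨d, hd, h1⟩ := h1
    obtain ⟨e, he, h2⟩ := h2
    obtain ⟨r, hr⟩ := exists_add_pow_prime_eq hp x y
    refine ⟨d + e - x * y * r, sub_mem (add_mem hd he) (Ideal.mul_mem_right _ _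
      (Ideal.mul_mem_right _ _ hx)), ?_⟩
    rw [map_add, h1, h2, hr]
    ring
  | smul a x hx h =>
    obtain ⟨d, hd, h⟩ := h
    obtain ⟨e, he⟩ := hfrob a
    refine ⟨a ^ p * d + e * x ^ p + p * e * d, add_mem (add_mem (Ideal.mul_mem_left _ _ hd)
      (Ideal.mul_mem_left _ _ (Ideal.pow_mem_of_mem _ hx _ hp.pos))) (Ideal.mul_mem_left _ _ hd), ?_⟩
    rw [smul_eq_mul, map_mul, h, he]
    ring

/-- Every defining relation is a difference `a - b`. As `(a - b) ^ p` and `a ^ p - b ^ p` differ by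
`p` times a multiple of `a - b`, it is enough to compare `δ(a)` with `δ(b)` modulo `I`. -/
theorem exists_delta_sub {P : Type*} [CommRing P] {p : ℕ} (hp : p.Prime) {φ : P →+* P}
    {I : Ideal P} {a b d e : P} (hab : a - b ∈ I) (hde : d - e ∈ I) (ha : φ a = a ^ p + p * d)
    (hb : φ b = b ^ p + p * e) : ∃ c ∈ I, φ (a - b) = (a - b) ^ p + p * c := by
  obtain ⟨r, hr⟩ := exists_add_pow_prime_eq hp b (a - b)
  rw [add_sub_cancel] at hr
  refine ⟨b * (a - b) * r + (d - e), add_mem (Ideal.mul_mem_right _ _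
    (Ideal.mul_mem_left _ _ hab)) hde, ?_⟩
  rw [map_sub, ha, hb, hr]
  ring

/-- From `p φ(x) = (p x) ^ p + p d` with `d ∈ I`, cancel `p` in `P`: `φ(x) = p ^ (p - 1) x ^ p + d`
lies in `I`, and `φ(x) ≡ x` modulo `I`. -/
theorem mem_of_prime_mul_mem {P : Type*} [CommRing P] [IsDomain P] [CharZero P] {p : ℕ}
    (hp : p.Prime) {φ : P →+* P} {I : Ideal P} (hφ : ∀ x, φ x - x ∈ I)
    (hI : ∀ x ∈ I, ∃ d ∈ I, φ x = x ^ p + p * d) {x : P} (hx : p * x ∈ I) : x ∈ I := by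
  obtain ⟨d, hd, h⟩ := hI _ hx
  obtain ⟨k, rfl⟩ := Nat.exists_eq_add_of_le hp.two_le
  have h1 : φ x = ((2 + k : ℕ) : P) * x * ((2 + k : ℕ) ^ k * x ^ (1 + k)) + d := by
    refine mul_left_cancel₀ (Nat.cast_ne_zero.2 hp.ne_zero : ((2 + k : ℕ) : P) ≠ 0) ?_
    rw [map_mul, map_natCast] at h
    rw [h]
    ring
  have h2 : φ x ∈ I := by
    rw [h1]
    exact add_mem (Ideal.mul_mem_right _ _ hx) hd
  simpa using sub_mem h2 (hφ x)

variable {G Ω : Type u} [Group G] [MulAction G Ω] [Tame G Ω]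

variable (p : ℕ) [hp : Fact p.Prime]

/-- The class of the nonconstant cyclic words in the fibers of a map. -/
noncomputable def Mor.ncCls (f : Mor G (stabClass G Ω)) : Theta G (stabClass G Ω) :=
  haveI := f.transitive.trans
  Oligo.cls Ω (ncHom p f.hom)

theorem Mor.cls_pow (f : Mor G (stabClass G Ω)) : f.cls ^ p = f.cls + p * f.ncCls p :=
  haveI := f.transitive.trans
  cls_pow_prime f.hom

/-- A lift to the polynomial ring of minus the class of the nonconstant cyclic words. -/
noncomputable def Mor.delta (f : Mor G (stabClass G Ω)) : MvPolynomial (Mor G (stabClass G Ω)) ℤ :=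
  Function.surjInv Ideal.Quotient.mk_surjective (-f.ncCls p)

/-- The lift of Frobenius to the polynomial ring in the symbols that induces the identity of
`Theta`. -/
noncomputable def frobLift :
    MvPolynomial (Mor G (stabClass G Ω)) ℤ →+* MvPolynomial (Mor G (stabClass G Ω)) ℤ :=
  MvPolynomial.eval₂Hom (Int.castRingHom _) fun f => MvPolynomial.X (R := ℤ) f ^ p + p * f.delta p

/-- The quotient map to `Theta`. -/
noncomputable abbrev thetaMk : MvPolynomial (Mor G (stabClass G Ω)) ℤ →+* Theta G (stabClass G Ω) :=
  Ideal.Quotient.mk _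

theorem exists_frobLift_X (f : Mor G (stabClass G Ω)) :
    ∃ d : MvPolynomial (Mor G (stabClass G Ω)) ℤ, thetaMk d = -f.ncCls p ∧
    frobLift p (MvPolynomial.X (R := ℤ) f) = MvPolynomial.X (R := ℤ) f ^ p + p * d :=
  ⟨f.delta p, Function.surjInv_eq Ideal.Quotient.mk_surjective (-f.ncCls p),
    MvPolynomial.eval₂Hom_X' _ _ f⟩

theorem thetaMk_frobLift (x : MvPolynomial (Mor G (stabClass G Ω)) ℤ) :
    thetaMk (frobLift p x) = thetaMk x := by
  induction x using MvPolynomial.induction_on with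
  | C a => simp
  | add a b ha hb => rw [map_add, map_add, map_add, ha, hb]
  | mul_X a f ha =>
    obtain ⟨d, hd, h⟩ := exists_frobLift_X p f
    rw [map_mul, map_mul, map_mul, ha, h, map_add, map_pow, map_mul, hd, map_natCast]
    have := f.cls_pow p
    change _ * (f.cls ^ p + _) = _ * f.cls
    rw [this]
    ring

theorem exists_frobLift_eq (x : MvPolynomial (Mor G (stabClass G Ω)) ℤ) :
    ∃ d : MvPolynomial (Mor G (stabClass G Ω)) ℤ, frobLift p x = x ^ p + p * d := by
  induction x using MvPolynomial.induction_on with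
  | C a =>
    have h : (p : ℤ) ∣ a - a ^ p := by
      rw [← ZMod.intCast_zmod_eq_zero_iff_dvd]
      push_cast
      rw [ZMod.pow_card, sub_self]
    obtain ⟨d, hd⟩ := h
    refine ⟨MvPolynomial.C d, ?_⟩
    have hC : frobLift (G := G) (Ω := Ω) p (MvPolynomial.C a) = MvPolynomial.C a := by
      simp
    rw [hC, ← map_pow, ← map_natCast (MvPolynomial.C : ℤ →+* MvPolynomial _ ℤ), ← map_mul,
      ← map_add, ← hd, add_sub_cancel]
  | add a b ha hb =>
    obtain ⟨d, hd⟩ := ha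
    obtain ⟨e, he⟩ := hb
    obtain ⟨r, hr⟩ := exists_add_pow_prime_eq hp.out a b
    refine ⟨d + e - a * b * r, ?_⟩
    rw [map_add, hd, he, hr]
    ring
  | mul_X a f ha =>
    obtain ⟨d, hd⟩ := ha
    obtain ⟨e, -, he⟩ := exists_frobLift_X p f
    refine ⟨a ^ p * e + d * MvPolynomial.X (R := ℤ) f ^ p + p * d * e, ?_⟩
    rw [map_mul, hd, he]
    ring

/-- Modulo the relations, `δ` of a symbol is `[f]` minus the class of all cyclic words, so each case
is an identity for `cycCls`. -/
theorem exists_delta_mem_of_rel {q : MvPolynomial (Mor G (stabClass G Ω)) ℤ} (h : Rel q) :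
    ∃ d ∈ Ideal.span {q : MvPolynomial (Mor G (stabClass G Ω)) ℤ | Rel q},
      frobLift p q = q ^ p + p * d := by
  have hq : q ∈ Ideal.span {q : MvPolynomial (Mor G (stabClass G Ω)) ℤ | Rel q} :=
    Ideal.subset_span h
  have key : ∀ f : Mor G (stabClass G Ω), haveI := f.transitive.trans
      f.ncCls p = cycCls Ω p f.hom - f.cls := fun f => by
    have := f.transitive.trans
    rw [cycCls_eq_cls_add]
    exact (add_sub_cancel_left _ _).symm
  cases h with
  | @iso Y X hX f hf =>
    obtain ⟨d, hd, he⟩ := exists_frobLift_X p ⟨Y, X, f, hX⟩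
    have := hX.trans
    refine exists_delta_sub hp.out (e := 0) hq ?_ he (by simp)
    rw [← Ideal.Quotient.eq_zero_iff_mem, sub_zero]
    refine hd.trans ?_
    rw [key, neg_eq_zero, sub_eq_zero]
    exact (cycCls_eq_one hf).trans (cls_eq_one Ω hf).symm
  | @add Y Y₁ Y₂ X hX f i j hij =>
    obtain ⟨d, hd, he⟩ := exists_frobLift_X p ⟨Y, X, f, hX⟩
    obtain ⟨d₁, hd₁, he₁⟩ := exists_frobLift_X p ⟨Y₁, X, f.comp i, hX⟩
    obtain ⟨d₂, hd₂, he₂⟩ := exists_frobLift_X p ⟨Y₂, X, f.comp j, hX⟩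
    have := hX.trans
    set x₁ : MvPolynomial (Mor G (stabClass G Ω)) ℤ := MvPolynomial.X ⟨Y₁, X, f.comp i, hX⟩
    set x₂ : MvPolynomial (Mor G (stabClass G Ω)) ℤ := MvPolynomial.X ⟨Y₂, X, f.comp j, hX⟩
    have hs := sum_pow_prime p fun b : Bool => cond b x₁ x₂
    simp only [Fintype.sum_bool, cond_true, cond_false] at hs
    -- `e` is `δ(x₁ + x₂)`: the mixed terms of `(x₁ + x₂) ^ p` divided by `p` are the nonconstant
    -- cyclic words in two letters, as in `cycCls_add`.
    refine exists_delta_sub hp.out (e := d₁ + d₂ - ncSum p fun b : Bool => cond b x₁ x₂) hq ?_ he ?_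
    · rw [← Ideal.Quotient.eq_zero_iff_mem, map_sub, map_sub, map_add, map_ncSum]
      refine (congrArg₂ (· - ·) hd (congrArg₂ (· - ·) (congrArg₂ (· + ·) hd₁ hd₂) rfl)).trans ?_
      have h1 := cycCls_add (Ω := Ω) (p := p) f i j hij
      have h2 := cls_add Ω f i j hij
      have h3 : (fun b : Bool => thetaMk (cond b x₁ x₂)) =
          fun b : Bool => cond b (cls Ω (f.comp i)) (cls Ω (f.comp j)) := by
        funext b; cases b <;> rfl
      change _ - (_ - ncSum p fun b : Bool => thetaMk (cond b x₁ x₂)) = 0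
      rw [h3, key, key, key]
      change -(cycCls Ω p f - cls Ω f) - (-(cycCls Ω p (f.comp i) - cls Ω (f.comp i)) +
        -(cycCls Ω p (f.comp j) - cls Ω (f.comp j)) - _) = 0
      rw [h1, h2]
      ring
    · rw [map_add, he₁, he₂, hs]
      ring
  | @comp Z Y X hZ hY hX f g =>
    obtain ⟨d, hd, he⟩ := exists_frobLift_X p ⟨Z, X, f.comp g, hX⟩
    obtain ⟨d₁, hd₁, he₁⟩ := exists_frobLift_X p ⟨Y, X, f, hX⟩
    obtain ⟨d₂, hd₂, he₂⟩ := exists_frobLift_X p ⟨Z, Y, g, hY⟩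
    have := hX.trans
    have := hY.trans
    have := hZ.trans
    set x₁ : MvPolynomial (Mor G (stabClass G Ω)) ℤ := MvPolynomial.X ⟨Y, X, f, hX⟩
    set x₂ : MvPolynomial (Mor G (stabClass G Ω)) ℤ := MvPolynomial.X ⟨Z, Y, g, hY⟩
    -- `e` is `δ(x₁ x₂)`, read off from the product of `x₁ ^ p + p d₁` and `x₂ ^ p + p d₂`.
    refine exists_delta_sub hp.out (e := x₁ ^ p * d₂ + d₁ * x₂ ^ p + p * d₁ * d₂) hq ?_ he ?_
    · rw [← Ideal.Quotient.eq_zero_iff_mem, map_sub, map_add, map_add, map_mul, map_mul, map_mul,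
        map_mul, map_pow, map_pow, map_natCast]
      have hd : (Ideal.Quotient.mk _ d : Theta G (stabClass G Ω)) = _ := hd
      have hd₁ : (Ideal.Quotient.mk _ d₁ : Theta G (stabClass G Ω)) = _ := hd₁
      have hd₂ : (Ideal.Quotient.mk _ d₂ : Theta G (stabClass G Ω)) = _ := hd₂
      rw [hd, hd₁, hd₂, key ⟨Z, X, f.comp g, hX⟩]
      have h1 := cycCls_comp (Ω := Ω) (p := p) f g
      have h2 := cls_comp Ω f g
      have h3 := cycCls_eq_cls_add (Ω := Ω) (p := p) g
      have h4 := cls_pow_prime (Ω := Ω) (p := p) f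
      change -(cycCls Ω p (f.comp g) - cls Ω (f.comp g)) -
        (cls Ω f ^ p * -cls Ω (ncHom p g) + -cls Ω (ncHom p f) * cls Ω g ^ p +
        p * -cls Ω (ncHom p f) * -cls Ω (ncHom p g)) = 0
      rw [h1, h2, h3, h4]
      ring
    · rw [map_mul, he₁, he₂]
      ring
  | @baseChange Y' X' Y X hX hX' f' f h g hsq =>
    obtain ⟨d, hd, he⟩ := exists_frobLift_X p ⟨Y, X, f, hX⟩
    obtain ⟨d', hd', he'⟩ := exists_frobLift_X p ⟨Y', X', f', hX'⟩
    have := hX.trans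
    have := hX'.trans
    refine exists_delta_sub hp.out hq ?_ he he'
    rw [← Ideal.Quotient.eq_zero_iff_mem, map_sub]
    refine (congrArg₂ (· - ·) hd hd').trans ?_
    have h1 : cycCls Ω p f' = cycCls Ω p f := cycCls_eq_of_cart hsq
    have h2 : cls Ω f' = cls Ω f := cls_eq_of_cart Ω hsq
    change -Mor.ncCls p _ - -Mor.ncCls p _ = 0
    rw [key, key]
    change -(cycCls Ω p f - cls Ω f) - -(cycCls Ω p f' - cls Ω f') = 0
    rw [h1, h2]
    ring

variable {p}

theorem theta_eq_zero_of_prime_mul_eq_zero {x : Theta G (stabClass G Ω)} (h : p * x = 0) :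
    x = 0 := by
  obtain ⟨y, rfl⟩ := Ideal.Quotient.mk_surjective x
  rw [← map_natCast (Ideal.Quotient.mk _), ← map_mul, Ideal.Quotient.eq_zero_iff_mem] at h
  rw [Ideal.Quotient.eq_zero_iff_mem]
  refine mem_of_prime_mul_mem hp.out (φ := frobLift p) (fun x => ?_) (fun x hx => ?_) h
  · rw [← Ideal.Quotient.eq_zero_iff_mem, map_sub, sub_eq_zero]
    exact thetaMk_frobLift p x
  · exact exists_delta_mem_of_mem_span hp.out (exists_frobLift_eq p)
      (fun r hr => exists_delta_mem_of_rel p hr) hx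

/-- The ring `Theta` is torsion-free. -/
theorem theta_eq_zero_of_natCast_mul_eq_zero {n : ℕ} (hn : n ≠ 0) {x : Theta G (stabClass G Ω)}
    (h : n * x = 0) : x = 0 := by
  induction n using Nat.recOnMul generalizing x with
  | zero => exact absurd rfl hn
  | one => simpa using h
  | prime q hq =>
    have : Fact q.Prime := ⟨hq⟩
    exact theta_eq_zero_of_prime_mul_eq_zero h
  | mul a b ha hb =>
    rw [Nat.cast_mul, mul_assoc] at h
    exact hb (right_ne_zero_of_mul hn) (ha (left_ne_zero_of_mul hn) h)

/-- The Frobenius lift induces the identity on `Theta`. -/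
theorem theta_frob (x : Theta G (stabClass G Ω)) : ∃ d, x = x ^ p + p * d := by
  obtain ⟨y, rfl⟩ := Ideal.Quotient.mk_surjective x
  obtain ⟨d, hd⟩ := exists_frobLift_eq p y
  refine ⟨thetaMk d, ?_⟩
  have := thetaMk_frobLift p y
  rw [hd, map_add, map_mul, map_pow, map_natCast] at this
  exact this.symm

end Delta

/-! ### Generation by basic classes, and the refined power relation. -/

section Generation

variable {G Ω : Type u} [Group G] [MulAction G Ω]
variable {X Y : Type u} [MulAction G X] [MulAction G Y]

theorem bijective_of_stabilizer_le [hY : Trans G Y] [hX : Trans G X] (f : Y →[G] X) (y : Y)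
    (h : stabilizer G (f y) ≤ stabilizer G y) : Function.Bijective f := by
  constructor
  · intro a b hab
    obtain ⟨g, rfl⟩ := hY.exists_smul_eq y a
    obtain ⟨g', rfl⟩ := hY.exists_smul_eq y b
    rw [map_smul, map_smul] at hab
    have : g'⁻¹ * g ∈ stabilizer G (f y) := by
      rw [mem_stabilizer_iff, mul_smul, hab, inv_smul_smul]
    have := h this
    rwa [mem_stabilizer_iff, mul_smul, inv_smul_eq_iff] at this
  · intro x
    obtain ⟨g, rfl⟩ := hX.exists_smul_eq (f y) x
    exact ⟨g • y, map_smul f g y⟩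

theorem hom_ext_of_trans [hY : Trans G Y] {f f' : Y →[G] X} (y : Y) (h : f y = f' y) : f = f' := by
  ext z
  obtain ⟨g, rfl⟩ := hY.exists_smul_eq y z
  rw [map_smul, map_smul, h]

theorem stabilizer_orbitSet {n : ℕ} {y : Fin n → Ω} (z : orbitSet G y) :
    stabilizer G z = stabilizer G (z.1 : Fin n → Ω) := by
  ext g
  simp only [mem_stabilizer_iff]
  exact Subtype.ext_iff

theorem stabilizer_snoc {n : ℕ} (a : Fin n → Ω) (ω : Ω) :
    stabilizer G (Fin.snoc a ω : Fin (n + 1) → Ω) = stabilizer G a ⊓ stabilizer G ω := by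
  ext g
  simp only [Subgroup.mem_inf, mem_stabilizer_iff, funext_iff, Pi.smul_apply]
  constructor
  · intro h
    exact ⟨fun i => by simpa using h i.castSucc, by simpa using h (Fin.last n)⟩
  · rintro ⟨h1, h2⟩ i
    refine Fin.lastCases ?_ (fun i => ?_) i
    · simpa using h2
    · simpa using h1 i

variable (G Ω) in
/-- The basic classes. -/
def basicClasses : Set (Theta G (stabClass G Ω)) :=
  {x | ∃ (l : ℕ) (y : Fin (l + 1) → Ω), x = (basicMap G y).cls}

/-- A map of transitive sets obtained by adjoining `m` points of `Ω` has a class that is a combination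
of products of `m` basic classes. -/
theorem cls_mem_spanPow (m : ℕ) : ∀ {l : ℕ} (a : Fin l → Ω) (b : Fin m → Ω)
    {X Y : Type u} [MulAction G X] [MulAction G Y] [Smooth G Ω X] [Smooth G Ω Y] [Trans G X]
    [Trans G Y] (f : Y →[G] X) (y : Y), stabilizer G (f y) = stabilizer G a →
    stabilizer G y = stabilizer G a ⊓ stabilizer G b → cls Ω f ∈ spanPow (basicClasses G Ω) m := by
  induction m with
  | zero =>
    intro l a b X Y _ _ _ _ _ _ f y h1 h2
    have hb : stabilizer G b = ⊤ := by
      ext g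
      simpa [mem_stabilizer_iff] using Subsingleton.elim _ _
    rw [cls_eq_one Ω (bijective_of_stabilizer_le f y (by rw [h1, h2, hb, inf_top_eq]))]
    exact one_mem_spanPow_zero _
  | succ m ih =>
    intro l a b X Y _ _ _ _ _ _ f y h1 h2
    set c : Fin (l + 1) → Ω := Fin.snoc a (b 0) with hc
    have := (orbitSet_isTransitive G c).trans
    have := (orbitSet_isTransitive G (Fin.init c)).trans
    let w : orbitSet G c := ⟨c, mem_orbit_self c⟩
    let v : orbitSet G (Fin.init c) := ⟨Fin.init c, mem_orbit_self _⟩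
    let bm : orbitSet G c →[G] orbitSet G (Fin.init c) := (basicMap G c).hom
    have hw : stabilizer G w = stabilizer G a ⊓ stabilizer G (b 0) := by
      rw [stabilizer_orbitSet, ← stabilizer_snoc]
    have hv : stabilizer G v = stabilizer G a := by
      rw [stabilizer_orbitSet]
      change stabilizer G (Fin.init c) = _
      rw [hc, Fin.init_snoc]
    have hb : stabilizer G b = stabilizer G (b 0) ⊓ stabilizer G (Fin.tail b) := by
      ext g
      simp only [Subgroup.mem_inf, mem_stabilizer_iff, funext_iff, Pi.smul_apply, Fin.forall_fin_succ,
        Fin.tail]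
    obtain ⟨k, hk⟩ := exists_hom_of_stabilizer_le v (f y) (by rw [hv, h1])
    obtain ⟨g, hg⟩ := exists_hom_of_stabilizer_le y w (by
      rw [hw, h2, hb, ← inf_assoc]; exact inf_le_left)
    have hkb : Function.Bijective k := bijective_of_stabilizer_le k v (by rw [hk, h1, hv])
    -- Adjoin the point `b 0` first: up to the isomorphism `k`, this step is a basic map, and `g`
    -- adjoins the remaining `m` points.
    have hf : f = (k.comp bm).comp g := by
      refine hom_ext_of_trans y ?_
      rw [MulActionHom.comp_apply, MulActionHom.comp_apply, hg]
      exact hk.symm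
    have hcart : Cart bm (k.comp bm) (MulActionHom.id G) k :=
      Cart.of_bijective Function.bijective_id hkb fun _ => rfl
    rw [hf, cls_comp_of_trans, ← cls_eq_of_cart Ω hcart]
    refine mul_mem_spanPow_succ ⟨l, c, rfl⟩ ?_
    refine ih c (Fin.tail b) g y ?_ ?_
    · rw [hg, stabilizer_orbitSet]
    · rw [h2, hb, hc, stabilizer_snoc, inf_assoc]

theorem exists_stabilizer_eq_tuple [hY : Smooth G Ω Y] (y : Y) :
    ∃ (n : ℕ) (a : Fin n → Ω), stabilizer G y = stabilizer G a := by
  obtain ⟨A, hA⟩ := hY.stabilizer_mem y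
  refine ⟨A.card, fun i => A.equivFin.symm i, ?_⟩
  rw [hA]
  ext g
  simp only [mem_fixingSubgroup_iff, mem_stabilizer_iff, funext_iff, Pi.smul_apply]
  constructor
  · exact fun h i => h _ (A.equivFin.symm i).2
  · intro h a ha
    simpa using h (A.equivFin ⟨a, ha⟩)

/-- The ring `Theta` is generated by the basic classes. -/
theorem closure_basicClasses : Subring.closure (basicClasses G Ω) = ⊤ := by
  set S := Subring.closure (basicClasses G Ω)
  have hcls : ∀ f : Mor G (stabClass G Ω), f.cls ∈ S := by
    intro f
    have := f.transitive.trans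
    have := Smooth.finitary (G := G) (Ω := Ω) (T := f.source)
    have := Fintype.ofFinite (orbitRel.Quotient G f.source)
    change cls Ω f.hom ∈ S
    rw [cls_eq_sum Ω f.hom orbMk orbMk_smul]
    refine sum_mem fun q _ => ?_
    obtain ⟨y⟩ := (trans_fiberSub_orbMk q).nonempty
    set g := f.hom.comp (fiberSub orbMk orbMk_smul q).inclusion
    obtain ⟨l, a, ha⟩ := exists_stabilizer_eq_tuple (G := G) (Ω := Ω) (g y)
    obtain ⟨m, b, hb⟩ := exists_stabilizer_eq_tuple (G := G) (Ω := Ω) y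
    refine mem_closure_of_mem_spanPow (n := m)
      (cls_mem_spanPow m a b g y ha ?_)
    rw [← ha, ← hb, right_eq_inf]
    exact stabilizer_le_map g y
  rw [eq_top_iff]
  rintro x -
  obtain ⟨q, rfl⟩ := Ideal.Quotient.mk_surjective x
  induction q using MvPolynomial.induction_on with
  | C a => simp
  | add a b ha hb => rw [map_add]; exact add_mem ha hb
  | mul_X a f ha => rw [map_mul]; exact mul_mem ha (hcls f)

variable [Tame G Ω] {p : ℕ} [hp : Fact p.Prime]

theorem exists_cls_pow_sub_eq [Smooth G Ω X] [Smooth G Ω Y] [Trans G X] [Trans G Y] (f : Y →[G] X) :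
    ∃ c, cls Ω f ^ p - cls Ω f = (p : Theta G (stabClass G Ω)) * cls Ω f * c := by
  obtain ⟨c, -, hc⟩ := exists_cls_ncHom_eq_mul (Ω := Ω) (p := p) f ⊤ fun _ => by simp
  exact ⟨c, by rw [cls_pow_prime, hc]; ring⟩

/-- The letters of a word in a fiber are tuples with the same first `l` coordinates. Given the first
letter, the word is thus determined by the last coordinates of the other `p - 1` letters. -/
theorem exists_basicMap_pow_sub_eq {l : ℕ} (y : Fin (l + 1) → Ω) :
    ∃ c ∈ spanPow (basicClasses G Ω) (p - 1),
      (basicMap G y).cls ^ p - (basicMap G y).cls = (p : Theta G (stabClass G Ω)) * (basicMap G y).cls * c := by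
  have := (orbitSet_isTransitive G y).trans
  have := (orbitSet_isTransitive G (Fin.init y)).trans
  have key := exists_cls_ncHom_eq_mul (Ω := Ω) (p := p) (basicMap G y).hom
    (X := orbitSet G (Fin.init y)) (Y := orbitSet G y) (spanPow (basicClasses G Ω) (p - 1)) ?_
  · obtain ⟨c, hc, hc'⟩ := key
    refine ⟨c, hc, ?_⟩
    have h := cls_pow_prime (Ω := Ω) (p := p) (X := orbitSet G (Fin.init y)) (Y := orbitSet G y)
      (basicMap G y).hom
    refine (congrArg (· - (basicMap G y).cls) h).trans ?_
    rw [hc']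
    change (basicMap G y).cls + _ - (basicMap G y).cls = _
    rw [add_sub_cancel_left, mul_assoc]
    rfl
  · intro O _ _ hO s s₀ hs₀ hf hst
    obtain ⟨o⟩ := hO.nonempty
    -- Letter 0 is `s₀ o`; the shift by one enumerates the letters `1, ..., p - 1`.
    refine cls_mem_spanPow (p - 1) (s₀ o).1
      (fun i : Fin (p - 1) => (s o ((i : ℕ) + 1 : ℕ)).1 (Fin.last l)) s₀ o
      (stabilizer_orbitSet _) ?_
    rw [hst, stabilizer_pi]
    ext g
    simp only [Subgroup.mem_iInf, Subgroup.mem_inf, stabilizer_orbitSet]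
    simp only [mem_stabilizer_iff, funext_iff, Pi.smul_apply]
    have hinit : ∀ i (j : Fin l), (s o i).1 j.castSucc = (s₀ o).1 j.castSucc := fun i j =>
      congrFun (congrArg Subtype.val (hf o i)) j
    constructor
    · intro h
      refine ⟨fun j => ?_, fun i => h _ _⟩
      rw [hs₀]
      exact h 0 j
    · rintro ⟨h1, h2⟩ i j
      refine Fin.lastCases ?_ (fun j => ?_) j
      · by_cases hi : i = 0
        · rw [hi, ← hs₀]
          exact h1 _
        · have h0 : i.val ≠ 0 := fun h => hi ((ZMod.val_eq_zero i).1 h)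
          have hlt := ZMod.val_lt i
          have := h2 ⟨i.val - 1, by omega⟩
          simpa only [Nat.sub_add_cancel (Nat.one_le_iff_ne_zero.2 h0), ZMod.natCast_zmod_val]
            using this
      · rw [hinit]
        exact h1 _

end Generation

/-! ### Assembly: the isomorphism and the possible values of a class. -/

section Main

variable {G Ω : Type u} [Group G] [MulAction G Ω]

theorem IND.tame (hG : IsOligomorphic G Ω) (hind : IND G Ω 1) : Tame G Ω where
  oligomorphic := hG
  stabilizer_le A := by
    obtain ⟨s, hs⟩ := hind A
    rw [one_pow, Nat.dvd_one] at hs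
    exact Subgroup.relIndex_eq_one.1 hs

theorem exists_theta_ringEquiv [Tame G Ω] (hgen : GENOne G Ω) :
    ∃ n : ℕ, Nonempty (Theta G (stabClass G Ω) ≃+* (Fin n → ℤ)) := by
  refine exists_ringEquiv_pi_int_of_generators (closure_fg_of_span_fg hgen) closure_basicClasses ?_
    (fun n x hn => theta_eq_zero_of_natCast_mul_eq_zero hn) fun p hp x => ?_
  · rintro _ ⟨l, y, rfl⟩ p hp
    have : Fact p.Prime := ⟨hp⟩
    exact exists_basicMap_pow_sub_eq y
  · have : Fact p.Prime := ⟨hp⟩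
    exact theta_frob x

/-- A prime `p` dividing `a ≠ 0` would divide `a ^ (p - 1) - p c = 1`. -/
theorem int_trichotomy_of_pow_sub_eq {a : ℤ}
    (h : ∀ p : ℕ, p.Prime → ∃ c, a ^ p - a = p * a * c) : a = -1 ∨ a = 0 ∨ a = 1 := by
  by_contra! hne
  obtain ⟨h1, h2, h3⟩ := hne
  obtain ⟨p, hp, hpa⟩ := Nat.exists_prime_and_dvd (n := a.natAbs) (by omega)
  obtain ⟨c, hc⟩ := h p hp
  have hpa : (p : ℤ) ∣ a := Int.natCast_dvd.2 hpa
  have h4 : a ^ (p - 1) - 1 = p * c := by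
    refine mul_left_cancel₀ h2 ?_
    rw [mul_sub, ← pow_succ', Nat.sub_add_cancel hp.one_le, mul_one, hc]
    ring
  have h5 : (p : ℤ) ∣ a ^ (p - 1) := dvd_pow hpa (by have := hp.two_le; omega)
  have h6 : (p : ℤ) ∣ 1 := by
    have : (1 : ℤ) = a ^ (p - 1) - p * c := by rw [← h4]; ring
    rw [this]
    exact dvd_sub h5 (dvd_mul_right _ _)
  exact (Nat.prime_iff_prime_int.1 hp).not_isUnit (isUnit_of_dvd_one h6)

theorem cls_trichotomy [Tame G Ω] (φ : Theta G (stabClass G Ω) →+* ℤ) (f : Mor G (stabClass G Ω))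
    (hf : f.source.IsTransitive) : φ f.cls = -1 ∨ φ f.cls = 0 ∨ φ f.cls = 1 := by
  refine int_trichotomy_of_pow_sub_eq fun p hp => ?_
  have : Fact p.Prime := ⟨hp⟩
  have := hf.trans
  have := f.transitive.trans
  obtain ⟨c, hc⟩ := exists_cls_pow_sub_eq (Ω := Ω) (p := p) f.hom
  refine ⟨φ c, ?_⟩
  have := congrArg φ hc
  rwa [map_sub, map_pow, map_mul, map_mul, map_natCast] at this

end Main

end Oligo

theorem corollary3p8 (G Ω : Type u) [Group G] [MulAction G Ω] [FaithfulSMul G Ω]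
    (hG : Oligo.IsOligomorphic G Ω) (hgen : Oligo.GENOne G Ω) (hind : Oligo.IND G Ω 1) :
    (∃ n : ℕ, Nonempty (Oligo.Theta G (Oligo.stabClass G Ω) ≃+* (Fin n → ℤ))) ∧
    ∀ (n : ℕ) (φ : Oligo.Theta G (Oligo.stabClass G Ω) ≃+* (Fin n → ℤ)),
      (∀ f : Oligo.Mor G (Oligo.stabClass G Ω), f.source.IsTransitive →
        ∀ i : Fin n, φ f.cls i = -1 ∨ φ f.cls i = 0 ∨ φ f.cls i = 1) ∧
      n ≤ 2 ^ Module.finrank ℤ (Oligo.thetaLEOne G Ω) := by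
  have := hind.tame hG
  refine ⟨Oligo.exists_theta_ringEquiv hgen, fun n φ => ⟨fun f hf i => ?_,
    Oligo.le_two_pow_finrank hgen Oligo.closure_basicClasses φ⟩⟩
  exact Oligo.cls_trichotomy ((Pi.evalRingHom _ i).comp (φ : _ →+* (Fin n → ℤ))) f hf
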